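/- Let $V:\mathbb N=\{1,2,3,\dots\}\to\mathbb R$ be a bounded function and let $H=-\frac{d^2}{dx^2}+\sum_{n\ge1}V(n)\,\delta(x-n)$ be the self-adjoint operator in $L^2(\mathbb R_+)$, $\mathbb R_+=[0,\infty)$, with the Dirichlet boundary condition at $x=0$, that is, the operator whose quadratic form is \[ \int_0^\infty |u'|^2\,dx+\sum_{n=1}^\infty V(n)|u(n)|^2,\qquad u\in W_0^{1,2}(\mathbb R_+). \] Let $p>1/2$, let $V\in\ell^{p+1/2}(\mathbb N)$, and assume that $\|V\|_\infty=\sup_n|V(n)|<2$. Let $E_j$ be the negative eigenvalues of $H$ (finitely or infinitely many, counted with multiplicity). Then \[ \sum_{j}|E_j|^p\le C_p\sum_{n=1}^\infty|V(n)|^{p+1/2}, \qquad\text{where}\qquad C_p=\frac{\sqrt2\int_0^4(1-\gamma/4)\,\gamma^{p-3/2}\,d\gamma}{\int_0^1(1-\gamma)^{1/2}\,\gamma^{p-3/2}\,d\gamma}. \] -/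

import Mathlib

open MeasureTheory Set
open scoped ENNReal ComplexConjugate ContDiff

noncomputable section

namespace DeltaSchrodinger

/-- Lebesgue measure on the half-line `(0, ∞)`. -/
def halfLine : Measure ℝ := volume.restrict (Ioi 0)

/-- The Hilbert space `L²(ℝ₊)` of complex-valued functions. -/
abbrev L2 : Type := Lp ℂ 2 halfLine

/-- `u ∈ W₀^{1,2}(ℝ₊)`, with (weak) derivative `u'`: on `[0, ∞)` the function `u` is locally
absolutely continuous with a.e. derivative `u'` and `u(0) = 0`, that is, `u(x) = ∫₀ˣ u'`, and both
`u` and `u'` are square integrable. So `u` is the continuous representative of its class, and its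
point values on `[0, ∞)` are meaningful. -/
structure IsW012 (u u' : ℝ → ℂ) : Prop where
  memLp : MemLp u 2 halfLine
  memLp_deriv : MemLp u' 2 halfLine
  eq_integral : ∀ x, 0 ≤ x → u x = ∫ t in (0 : ℝ)..x, u' t

/-- The sesquilinear form
`∫₀^∞ u' conj(v') dx + ∑_{n ≥ 1} V(n) u(n) conj(v(n))`. -/
def form (V : ℕ+ → ℝ) (u u' v v' : ℝ → ℂ) : ℂ :=
  (∫ x in Ioi (0 : ℝ), u' x * conj (v' x)) +
    ∑' n : ℕ+, (V n : ℂ) * u (n : ℝ) * conj (v (n : ℝ))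

namespace IsW012

variable {u u' v v' : ℝ → ℂ}

theorem intervalIntegrable_deriv (h : IsW012 u u') {a b : ℝ} (ha : 0 ≤ a) (hab : a ≤ b) :
    IntervalIntegrable u' volume a b := by
  rw [intervalIntegrable_iff_integrableOn_Ioc_of_le hab]
  have h1 : MemLp u' 2 (volume.restrict (Ioc a b)) := by
    refine h.memLp_deriv.mono_measure (Measure.restrict_mono ?_ le_rfl)
    intro x hx
    exact lt_of_le_of_lt ha hx.1
  exact h1.integrable (by norm_num)

theorem zero : IsW012 0 0 := ⟨MemLp.zero', MemLp.zero', by simp⟩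

theorem add (hu : IsW012 u u') (hv : IsW012 v v') : IsW012 (u + v) (u' + v') := by
  refine ⟨hu.memLp.add hv.memLp, hu.memLp_deriv.add hv.memLp_deriv, fun x hx => ?_⟩
  simp only [Pi.add_apply]
  rw [intervalIntegral.integral_add (hu.intervalIntegrable_deriv le_rfl hx)
    (hv.intervalIntegrable_deriv le_rfl hx), hu.eq_integral x hx, hv.eq_integral x hx]

theorem smul (c : ℂ) (hu : IsW012 u u') : IsW012 (c • u) (c • u') := by
  refine ⟨hu.memLp.const_smul c, hu.memLp_deriv.const_smul c, fun x hx => ?_⟩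
  simp only [Pi.smul_apply]
  rw [intervalIntegral.integral_smul, hu.eq_integral x hx]

/-- Test functions belong to `W₀^{1,2}(ℝ₊)`. -/
theorem of_testFunction {g : ℝ → ℝ} (hg : ContDiff ℝ ∞ g) (hc : HasCompactSupport g)
    (hs : tsupport g ⊆ Ioi 0) :
    IsW012 (fun x => (g x : ℂ)) (fun x => ((deriv g x : ℝ) : ℂ)) := by
  have hg' : Continuous (deriv g) := hg.continuous_deriv (by simp)
  refine ⟨?_, ?_, fun x _ => ?_⟩
  · refine MemLp.restrict _ (Continuous.memLp_of_hasCompactSupport (by fun_prop) ?_)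
    exact hc.comp_left (g := fun y : ℝ => (y : ℂ)) (by simp)
  · refine MemLp.restrict _ (Continuous.memLp_of_hasCompactSupport (by fun_prop) ?_)
    exact hc.deriv.comp_left (g := fun y : ℝ => (y : ℂ)) (by simp)
  · have h0 : g 0 = 0 := by
      apply image_eq_zero_of_notMem_tsupport
      intro h
      exact lt_irrefl (0 : ℝ) (hs h)
    rw [intervalIntegral.integral_ofReal, intervalIntegral.integral_deriv_eq_sub]
    · simp [h0]
    · intro y _
      exact hg.differentiable (by simp) y
    · exact hg'.intervalIntegrable _ _

/-- If `u` vanishes a.e. on the half-line, then so does its derivative, and `u` vanishes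
everywhere on `[0, ∞)`. -/
theorem eq_zero (hu : IsW012 u u') (h : u =ᵐ[halfLine] 0) :
    (∀ x, 0 ≤ x → u x = 0) ∧ u' =ᵐ[halfLine] 0 := by
  have hcont : ContinuousOn u (Ici 0) := by
    have h1 : ContinuousOn (fun x => ∫ t in (0 : ℝ)..x, u' t) (Ici 0) := by
      intro x hx
      have hx0 : (0 : ℝ) ≤ x := hx
      have h2 := intervalIntegral.continuousOn_primitive_interval
        ((intervalIntegrable_iff' (by simp)).1 (hu.intervalIntegrable_deriv le_rfl
          (show (0 : ℝ) ≤ x + 1 by linarith)))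
      rw [uIcc_of_le (by linarith)] at h2
      refine (h2 x ⟨hx0, by linarith⟩).mono_of_mem_nhdsWithin ?_
      rw [← Ici_inter_Iic]
      exact Filter.inter_mem self_mem_nhdsWithin
        (mem_nhdsWithin_of_mem_nhds (Iic_mem_nhds (by linarith)))
    exact h1.congr fun x hx => hu.eq_integral x hx
  have hz : ∀ x, 0 < x → u x = 0 := by
    have h3 : EqOn u 0 (Ioi 0) := by
      refine Measure.eqOn_open_of_ae_eq (μ := volume) h isOpen_Ioi
        (hcont.mono Ioi_subset_Ici_self) continuousOn_const
    exact fun x hx => h3 hx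
  have hz' : ∀ x, 0 ≤ x → u x = 0 := by
    intro x hx
    rcases hx.eq_or_lt with rfl | hx
    · simpa using hu.eq_integral 0 le_rfl
    · exact hz x hx
  refine ⟨hz', ?_⟩
  have hn : ∀ n : ℕ, ∀ᵐ x : ℝ, x ∈ Ioo (0 : ℝ) n → u' x = 0 := by
    intro n
    have h4 := (hu.intervalIntegrable_deriv le_rfl
      (Nat.cast_nonneg n : (0 : ℝ) ≤ n)).ae_hasDerivAt_integral
    filter_upwards [h4] with x hx hxn
    have h5 := hx (by rw [uIcc_of_le (by linarith [hxn.1, hxn.2])]; exact ⟨hxn.1.le, hxn.2.le⟩)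
      0 left_mem_uIcc
    have h6 : HasDerivAt (fun x => ∫ t in (0 : ℝ)..x, u' t) 0 x := by
      refine (hasDerivAt_const x (0 : ℂ)).congr_of_eventuallyEq ?_
      filter_upwards [Ioi_mem_nhds hxn.1] with y hy
      rw [← hu.eq_integral y (le_of_lt hy), hz y hy]
    exact h5.unique h6
  unfold halfLine
  rw [Filter.EventuallyEq, ae_restrict_iff' measurableSet_Ioi]
  filter_upwards [ae_all_iff.2 hn] with x hx hx0
  obtain ⟨n, hxn⟩ := exists_nat_gt x
  exact hx n ⟨hx0, hxn⟩

/-- Trace inequality: a value at the right end of a unit interval is controlled by the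
`W^{1,2}`-norm over that interval. -/
theorem norm_sq_le (hu : IsW012 u u') (n : ℕ) :
    ‖u (n + 1)‖ ^ 2 ≤ 2 * ∫ x in Ioc (n : ℝ) (n + 1), (‖u x‖ ^ 2 + ‖u' x‖ ^ 2) := by
  have hn : (0 : ℝ) ≤ n := Nat.cast_nonneg n
  have hsub : Ioc (n : ℝ) (n + 1) ⊆ Ioi 0 := fun x hx => lt_of_le_of_lt hn hx.1
  have m1 : MemLp u 2 (volume.restrict (Ioc (n : ℝ) (n + 1))) :=
    hu.memLp.mono_measure (Measure.restrict_mono hsub le_rfl)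
  have m2 : MemLp u' 2 (volume.restrict (Ioc (n : ℝ) (n + 1))) :=
    hu.memLp_deriv.mono_measure (Measure.restrict_mono hsub le_rfl)
  have i1 : Integrable (fun x => ‖u x‖) (volume.restrict (Ioc (n : ℝ) (n + 1))) :=
    (m1.integrable (by norm_num)).norm
  have i2 : Integrable (fun x => ‖u' x‖) (volume.restrict (Ioc (n : ℝ) (n + 1))) :=
    (m2.integrable (by norm_num)).norm
  have q1 : Integrable (fun x => ‖u x‖ ^ 2) (volume.restrict (Ioc (n : ℝ) (n + 1))) :=
    m1.integrable_norm_pow (by norm_num)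
  have q2 : Integrable (fun x => ‖u' x‖ ^ 2) (volume.restrict (Ioc (n : ℝ) (n + 1))) :=
    m2.integrable_norm_pow (by norm_num)
  have hvol : (volume.restrict (Ioc (n : ℝ) (n + 1))).real univ = 1 := by
    simp [Measure.real]
  set c := ‖u (n + 1)‖ with hc
  set B := ∫ y in Ioc (n : ℝ) (n + 1), ‖u' y‖ with hB
  -- pointwise bound
  have key : ∀ x ∈ Ioc (n : ℝ) (n + 1), c ≤ ‖u x‖ + B := by
    intro x hx
    have hx0 : 0 ≤ x := le_of_lt (hsub hx)
    have e : u (n + 1) = u x + ∫ t in x..(n + 1 : ℝ), u' t := by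
      rw [hu.eq_integral (n + 1) (by linarith), hu.eq_integral x hx0,
        intervalIntegral.integral_add_adjacent_intervals
          (hu.intervalIntegrable_deriv le_rfl hx0) (hu.intervalIntegrable_deriv hx0 hx.2)]
    have b : ‖∫ t in x..(n + 1 : ℝ), u' t‖ ≤ B := by
      rw [intervalIntegral.integral_of_le hx.2]
      refine (norm_integral_le_integral_norm _).trans ?_
      refine setIntegral_mono_set i2 (Filter.Eventually.of_forall fun _ => norm_nonneg _) ?_
      exact (Ioc_subset_Ioc_left hx.1.le).eventuallyLE
    calc c = ‖u x + ∫ t in x..(n + 1 : ℝ), u' t‖ := by rw [hc, e]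
      _ ≤ _ := (norm_add_le _ _).trans (by linarith)
  have hB2 : B ^ 2 ≤ ∫ x in Ioc (n : ℝ) (n + 1), ‖u' x‖ ^ 2 := by
    have h0 : 0 ≤ ∫ x in Ioc (n : ℝ) (n + 1), (‖u' x‖ - B) ^ 2 :=
      integral_nonneg fun _ => sq_nonneg _
    have h1 : ∫ x in Ioc (n : ℝ) (n + 1), (‖u' x‖ - B) ^ 2
        = ∫ x in Ioc (n : ℝ) (n + 1), (‖u' x‖ ^ 2 - 2 * B * ‖u' x‖ + B ^ 2) := by
      congr 1; ext x; ring
    have h2 : Integrable (fun x => ‖u' x‖ ^ 2 - 2 * B * ‖u' x‖)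
      (volume.restrict (Ioc (n : ℝ) (n + 1))) := q2.sub (i2.const_mul _)
    rw [h1, integral_add h2 (integrable_const _),
      integral_sub q2 (i2.const_mul _), integral_const_mul, integral_const, hvol, ← hB] at h0
    simp only [smul_eq_mul, one_mul] at h0
    nlinarith
  have h3 : ∫ _ in Ioc (n : ℝ) (n + 1), c ^ 2
      ≤ ∫ x in Ioc (n : ℝ) (n + 1), (2 * ‖u x‖ ^ 2 + 2 * B ^ 2) := by
    refine setIntegral_mono_on (integrable_const _)
      ((q1.const_mul 2).add (integrable_const _)) measurableSet_Ioc fun x hx => ?_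
    have hk := key x hx
    have hc0 : 0 ≤ c := norm_nonneg _
    nlinarith [sq_nonneg (‖u x‖ - B), mul_self_le_mul_self hc0 hk]
  rw [integral_add (q1.const_mul 2) (integrable_const _), integral_const_mul, integral_const,
    integral_const, hvol] at h3
  simp only [smul_eq_mul, one_mul] at h3
  rw [integral_add q1 q2]
  linarith

/-- The point values at the positive integers are square summable. -/
theorem summable_norm_sq (hu : IsW012 u u') : Summable fun n : ℕ+ => ‖u (n : ℝ)‖ ^ 2 := by
  have h1 : Integrable (fun x => ‖u x‖ ^ 2 + ‖u' x‖ ^ 2) halfLine :=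
    (hu.memLp.integrable_norm_pow (by norm_num)).add
      (hu.memLp_deriv.integrable_norm_pow (by norm_num))
  have hd : Pairwise (Function.onFun Disjoint fun n : ℕ => Ioc (n : ℝ) (n + 1)) := by
    intro m n hmn
    have := pairwise_disjoint_Ioc_intCast ℝ (show (m : ℤ) ≠ n by exact_mod_cast hmn)
    simpa [Function.onFun] using this
  have h2 := (hasSum_integral_iUnion (μ := volume) (f := fun x => ‖u x‖ ^ 2 + ‖u' x‖ ^ 2)
    (fun n : ℕ => measurableSet_Ioc (a := (n : ℝ)) (b := n + 1)) hd
    (IntegrableOn.mono_set h1 (iUnion_subset fun n x hx =>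
      lt_of_le_of_lt (Nat.cast_nonneg n : (0 : ℝ) ≤ n) hx.1))).summable
  have h3 : Summable fun n : ℕ => ‖u ((n : ℝ) + 1)‖ ^ 2 :=
    (h2.mul_left 2).of_nonneg_of_le (fun _ => sq_nonneg _) hu.norm_sq_le
  rw [← Equiv.summable_iff (Equiv.pnatEquivNat.symm)]
  refine h3.congr fun n => ?_
  simp [Equiv.pnatEquivNat]

end IsW012

/-- For bounded `V` the sum in the form converges. -/
theorem summable_form (V : lp (fun _ : ℕ+ => ℝ) ∞) {u u' v v' : ℝ → ℂ}
    (hu : IsW012 u u') (hv : IsW012 v v') :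
    Summable fun n : ℕ+ => (V n : ℂ) * u (n : ℝ) * conj (v (n : ℝ)) := by
  refine Summable.of_norm_bounded
    ((hu.summable_norm_sq.add hv.summable_norm_sq).mul_left ‖V‖) fun n => ?_
  have h1 : ‖V n‖ ≤ ‖V‖ := lp.norm_apply_le_norm (by simp) V n
  rw [norm_mul, norm_mul, RCLike.norm_conj, Complex.norm_real, mul_assoc]
  refine mul_le_mul h1 ?_ (by positivity) (norm_nonneg _)
  nlinarith [sq_nonneg (‖u n‖ - ‖v n‖), sq_nonneg ‖u n‖, sq_nonneg ‖v n‖]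

/-- The integral in the form converges. -/
theorem integrable_form {u u' v v' : ℝ → ℂ} (hu : IsW012 u u') (hv : IsW012 v v') :
    Integrable (fun x => u' x * conj (v' x)) halfLine :=
  hu.memLp_deriv.integrable_mul (hv.memLp_deriv.star)

theorem form_add (V : lp (fun _ : ℕ+ => ℝ) ∞) {u u' w w' v v' : ℝ → ℂ}
    (hu : IsW012 u u') (hw : IsW012 w w') (hv : IsW012 v v') :
    form V (u + w) (u' + w') v v' = form V u u' v v' + form V w w' v v' := by
  have h1 := integral_add (integrable_form hu hv) (integrable_form hw hv)
  have h2 := (summable_form V hu hv).tsum_add (summable_form V hw hv)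
  unfold halfLine at h1
  simp only [form, Pi.add_apply, add_mul, mul_add, h1, h2]
  ring

theorem form_smul (V : ℕ+ → ℝ) (c : ℂ) (u u' v v' : ℝ → ℂ) :
    form V (c • u) (c • u') v v' = c * form V u u' v v' := by
  simp only [form, Pi.smul_apply, smul_eq_mul, mul_add]
  rw [← integral_const_mul, ← tsum_mul_left]
  congr 2
  · ext x; ring
  · ext n; ring

/-- The graph of the operator `H` associated with the form: `(f, h)` belongs to it if and only if
`f` lies in the form domain `W₀^{1,2}(ℝ₊)` and `form(f, v) = ⟨h, v⟩` for all `v` in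
`W₀^{1,2}(ℝ₊)`. -/
def graph (V : lp (fun _ : ℕ+ => ℝ) ∞) : Submodule ℂ (L2 × L2) where
  carrier := {p | ∃ u u' : ℝ → ℂ, IsW012 u u' ∧ p.1 =ᵐ[halfLine] u ∧
    ∀ v v' : ℝ → ℂ, IsW012 v v' →
      form V u u' v v' = ∫ x in Ioi (0 : ℝ), p.2 x * conj (v x)}
  zero_mem' := by
    refine ⟨0, 0, IsW012.zero, Lp.coeFn_zero _ _ _, fun v v' _ => ?_⟩
    have h : ∫ x in Ioi (0 : ℝ), (0 : L2) x * conj (v x) = ∫ x in Ioi (0 : ℝ), (0 : ℂ) := by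
      refine integral_congr_ae ?_
      filter_upwards [show (0 : L2) =ᵐ[volume.restrict (Ioi 0)] 0 from Lp.coeFn_zero _ _ _]
        with x hx
      rw [hx, Pi.zero_apply, zero_mul]
    refine Eq.trans ?_ h.symm
    simp [form]
  add_mem' := by
    rintro ⟨f, h⟩ ⟨f₁, h₁⟩ ⟨u, u', hu, hfu, H⟩ ⟨w, w', hw, hfw, H₁⟩
    refine ⟨u + w, u' + w', hu.add hw, (Lp.coeFn_add f f₁).trans (hfu.add hfw),
      fun v v' hv => ?_⟩
    rw [form_add V hu hw hv, H v v' hv, H₁ v v' hv]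
    have i (g : L2) : Integrable (fun x => g x * conj (v x)) (volume.restrict (Ioi 0)) :=
      (Lp.memLp g).integrable_mul hv.memLp.star
    rw [← integral_add (i h) (i h₁)]
    refine integral_congr_ae ?_
    filter_upwards [show (h + h₁ : L2) =ᵐ[volume.restrict (Ioi 0)] h + h₁ from
      Lp.coeFn_add h h₁] with x hx
    change h x * _ + h₁ x * _ = (h + h₁ : L2) x * _
    rw [hx, Pi.add_apply, add_mul]
  smul_mem' := by
    rintro c ⟨f, h⟩ ⟨u, u', hu, hfu, H⟩
    refine ⟨c • u, c • u', hu.smul c, (Lp.coeFn_smul c f).trans (hfu.const_smul c),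
      fun v v' hv => ?_⟩
    rw [form_smul, H v v' hv, ← integral_const_mul]
    refine integral_congr_ae ?_
    filter_upwards [show (c • h : L2) =ᵐ[volume.restrict (Ioi 0)] c • h from
      Lp.coeFn_smul c h] with x hx
    change c * (h x * _) = (c • h : L2) x * _
    rw [hx, Pi.smul_apply, smul_eq_mul, mul_assoc]

/-- The graph is single-valued, because the form domain is dense in `L²(ℝ₊)`. -/
theorem graph_functional (V : lp (fun _ : ℕ+ => ℝ) ∞) (p : L2 × L2) (hp : p ∈ graph V)
    (h0 : p.1 = 0) : p.2 = 0 := by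
  obtain ⟨f, h⟩ := p
  obtain ⟨u, u', hu, hfu, H⟩ := hp
  simp only at h0 hfu H ⊢
  subst h0
  obtain ⟨hz, hz'⟩ := hu.eq_zero (hfu.symm.trans (Lp.coeFn_zero _ _ _))
  have hform : ∀ v v', form V u u' v v' = 0 := by
    intro v v'
    have e1 : ∫ x in Ioi (0 : ℝ), u' x * conj (v' x) = ∫ x in Ioi (0 : ℝ), (0 : ℂ) := by
      refine integral_congr_ae ?_
      filter_upwards [show u' =ᵐ[volume.restrict (Ioi 0)] 0 from hz'] with x hx
      simp [hx]
    simp [form, e1, hz]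
  have hloc : LocallyIntegrableOn (h : ℝ → ℂ) (Ioi 0) volume := by
    have h2 : MemLp h 2 (volume.restrict (Ioi 0)) := Lp.memLp h
    have := h2.locallyIntegrable (by norm_num)
    exact locallyIntegrableOn_of_locallyIntegrable_restrict this
  have hae := isOpen_Ioi.ae_eq_zero_of_integral_contDiff_smul_eq_zero hloc fun g hg hc hs => by
    have h1 := H _ _ (IsW012.of_testFunction hg hc hs)
    rw [hform] at h1
    rw [← setIntegral_eq_integral_of_forall_compl_eq_zero (s := Ioi 0), h1]
    · congr 1
      ext x
      simp [mul_comm]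
    · intro x hx
      rw [image_eq_zero_of_notMem_tsupport fun hx' => hx (hs hx'), zero_smul]
  refine (Lp.eq_zero_iff_ae_eq_zero).2 ?_
  unfold halfLine
  rwa [Filter.EventuallyEq, ae_restrict_iff' measurableSet_Ioi]

/-- The (unbounded) operator `H = -d²/dx² + ∑_{n ≥ 1} V(n) δ(x - n)` in `L²(ℝ₊)` with the Dirichlet
condition at `0`, that is, the operator whose quadratic form is
`∫₀^∞ |u'|² dx + ∑_{n ≥ 1} V(n) |u(n)|²` on `W₀^{1,2}(ℝ₊)`. -/
def hamiltonian (V : lp (fun _ : ℕ+ => ℝ) ∞) : L2 →ₗ.[ℂ] L2 :=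
  (graph V).toLinearPMap

theorem hamiltonian_graph (V : lp (fun _ : ℕ+ => ℝ) ∞) : (hamiltonian V).graph = graph V :=
  Submodule.toLinearPMap_graph_eq _ (graph_functional V)

/-- The eigenspace `{f ∈ dom T | T f = E f}` of an unbounded operator `T`. -/
def eigenspace (T : L2 →ₗ.[ℂ] L2) (E : ℝ) : Submodule ℂ L2 :=
  T.graph.comap (LinearMap.prod LinearMap.id ((E : ℂ) • LinearMap.id))

theorem mem_eigenspace_iff (T : L2 →ₗ.[ℂ] L2) (E : ℝ) (f : L2) :
    f ∈ eigenspace T E ↔ ∃ hf : f ∈ T.domain, T ⟨f, hf⟩ = (E : ℂ) • f := by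
  change (f, (E : ℂ) • f) ∈ T.graph ↔ _
  simp [LinearPMap.mem_graph_iff]

/-- The multiplicity of `E` as an eigenvalue of `T` (zero if `E` is not an eigenvalue). -/
def multiplicity (T : L2 →ₗ.[ℂ] L2) (E : ℝ) : ℕ∞ :=
  Cardinal.toENat (Module.rank ℂ (eigenspace T E))

/-- The sum `∑_j |E_j|^p` over the negative eigenvalues `E_j` of `T`, counted with multiplicity,
with value `∞` if it diverges. -/
def negEigenvalueMoment (T : L2 →ₗ.[ℂ] L2) (p : ℝ) : ℝ≥0∞ :=
  ∑' E : Iio (0 : ℝ), (multiplicity T E : ℝ≥0∞) * ENNReal.ofReal (|(E : ℝ)| ^ p)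

/-- The constant `C_p`. -/
def ltConst (p : ℝ) : ℝ :=
  √2 * (∫ γ in (0 : ℝ)..4, (1 - γ / 4) * γ ^ (p - 3 / 2)) /
    ∫ γ in (0 : ℝ)..1, (1 - γ) ^ (1 / 2 : ℝ) * γ ^ (p - 3 / 2)

end DeltaSchrodinger

end

/-! ### Sums of largest eigenvalues and Hadamard products. -/

namespace DeltaSchrodinger

open Matrix
open scoped ComplexOrder

/-! The proof bounds the moment of order `1/2` for the eigenvalues below `-t`, then integrates over
the spectral shift `t`.

Shift. For `0 ≤ t ≤ 8`, three quarters of the kinetic energy plus `t ∫ |u|²` dominate `(t/4) ∑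
|u(n)|²` (`IsW012.mul_tsum_le`). Hence `H + t` is bounded below by a quarter of the kinetic energy
with point potentials `-w`, where `w = (|V| - t/4)₊`. This `w` has finite support, because `V` tends
to zero. Rescaling by `4` and using the sharp `1/2`-moment bound for point interactions gives `∑
√(-E_j - t)₊ ≤ ∑ (|V(n)| - t/4)₊` (`sum_sqrt_le_of_monotone`). At `t = 8` the right side is zero
since `‖V‖ < 2`, so the bound persists for larger `t`.

The `1/2`-moment bound follows Hundertmark, Lieb and Thomas. If `-μ²` is the `k`-th eigenvalue for
the point potentials `-W`, the `k`-th eigenvalue of the Birman–Schwinger matrix `√W q^|m-n| √W`, `q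
= exp (-μ)`, is at least `2μ`. Lowering `q` is Hadamard multiplication by a correlation matrix,
which does not increase the sum of the `k` largest eigenvalues
(`IsSortedDiagonalization.sum_hadamard_le`). An induction therefore moves all eigenvalues to the
common value `q = 1`, where the trace is `∑ W` (`sum_le_sum_of_bsMatrix`).

Integration against `t^(p - 3/2) dt` turns the left side into `|E_j|^p` and the right side into
`|V(n)|^(p + 1/2)`, up to the two integrals in `C_p` (`sum_rpow_le`). Infinitely many eigenvalues
and infinite multiplicities are reached as suprema of finite orthonormal families. -/

/-- `A = U diag(l) U*` with `U` unitary and `l` in decreasing order. -/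
structure IsSortedDiagonalization {M : ℕ} (A U : Matrix (Fin M) (Fin M) ℂ) (l : Fin M → ℝ) :
    Prop where
  antitone : Antitone l
  star_mul : Uᴴ * U = 1
  mul_star : U * Uᴴ = 1
  eq : A = U * diagonal (fun i => (l i : ℂ)) * Uᴴ

theorem exists_isSortedDiagonalization {M : ℕ} {A : Matrix (Fin M) (Fin M) ℂ}
    (hA : A.IsHermitian) : ∃ U l, IsSortedDiagonalization A U l := by
  set σ := Tuple.sort (fun i => -hA.eigenvalues i)
  have hσ := Tuple.monotone_sort (fun i => -hA.eigenvalues i)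
  set U := (hA.eigenvectorUnitary : Matrix (Fin M) (Fin M) ℂ)
  have h1 : Uᴴ * U = 1 := (Unitary.mem_iff.1 hA.eigenvectorUnitary.2).1
  have h2 : U * Uᴴ = 1 := (Unitary.mem_iff.1 hA.eigenvectorUnitary.2).2
  have h3 : A = U * diagonal (fun i => (hA.eigenvalues i : ℂ)) * Uᴴ := by
    conv_lhs => rw [hA.spectral_theorem]
    rw [Unitary.conjStarAlgAut_apply]
    rfl
  refine ⟨U.submatrix id σ, fun i => hA.eigenvalues (σ i), ?_, ?_, ?_, ?_⟩
  · intro i j hij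
    have := hσ hij
    simp only [Function.comp_apply] at this
    linarith
  · rw [conjTranspose_submatrix, ← submatrix_mul _ _ _ _ _ Function.bijective_id, h1]
    ext i j
    simp [one_apply]
  · rw [conjTranspose_submatrix, ← submatrix_mul _ _ _ _ _ σ.bijective, h2, submatrix_id_id]
  · conv_lhs => rw [h3]
    ext i j
    rw [mul_apply, mul_apply]
    simp only [mul_diagonal, submatrix_apply, id, conjTranspose_apply]
    exact (Equiv.sum_comp σ fun x => U i x * (hA.eigenvalues x : ℂ) * star (U j x)).symm

/-- Compare with the threshold value `l k`: the sign of `l i - l k` makes every `(l i - l k) (q i -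
1_{i < k})` nonpositive, and equal total weights cancel the terms in `l k`. If `k ≥ M`, the weights
must all equal `1`. -/
theorem sum_mul_le_sum_ite_of_antitone {M : ℕ} {l q : Fin M → ℝ} (hl : Antitone l) (k : ℕ)
    (h0 : ∀ i, 0 ≤ q i) (h1 : ∀ i, q i ≤ 1)
    (hq : ∑ i, q i = ∑ i : Fin M, if (i : ℕ) < k then (1 : ℝ) else 0) :
    ∑ i, l i * q i ≤ ∑ i : Fin M, if (i : ℕ) < k then l i else 0 := by
  rcases lt_or_ge k M with hk | hk
  · have h : ∀ i : Fin M, (l i - l ⟨k, hk⟩) * q i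
        ≤ (l i - l ⟨k, hk⟩) * if (i : ℕ) < k then (1 : ℝ) else 0 := by
      intro i
      split_ifs with hi
      · exact mul_le_mul_of_nonneg_left (h1 i)
          (sub_nonneg.2 (hl (show i ≤ ⟨k, hk⟩ from Fin.le_def.2 hi.le)))
      · have h2 : l i ≤ l ⟨k, hk⟩ := hl (Fin.le_def.2 (not_lt.1 hi))
        nlinarith [h0 i]
    have h2 := Finset.sum_le_sum fun i (_ : i ∈ Finset.univ) => h i
    simp only [sub_mul, Finset.sum_sub_distrib, ← Finset.mul_sum, hq] at h2
    simpa using h2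
  · have hi : ∀ i : Fin M, (i : ℕ) < k := fun i => i.2.trans_le hk
    simp only [hi, if_true] at hq ⊢
    have h2 : ∑ i, (1 - q i) = 0 := by rw [Finset.sum_sub_distrib, hq, sub_self]
    have h3 := (Finset.sum_eq_zero_iff_of_nonneg fun i _ => sub_nonneg.2 (h1 i)).1 h2
    refine le_of_eq (Finset.sum_congr rfl fun i hi => ?_)
    rw [← sub_eq_zero.1 (h3 i hi), mul_one]

/-- Hadamard multiplication by a correlation matrix decreases the sum of the `k` largest
eigenvalues. -/
theorem IsSortedDiagonalization.sum_hadamard_le {M : ℕ} {A C U U' : Matrix (Fin M) (Fin M) ℂ}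
    {l l' : Fin M → ℝ} (h : IsSortedDiagonalization A U l)
    (h' : IsSortedDiagonalization (A ⊙ C) U' l') (hC : C.PosSemidef) (hC1 : ∀ i, C i i = 1)
    (k : ℕ) :
    (∑ i : Fin M, if (i : ℕ) < k then l' i else 0) ≤
      ∑ i : Fin M, if (i : ℕ) < k then l i else 0 := by
  set χ : Fin M → ℂ := fun i => if (i : ℕ) < k then 1 else 0
  have hχ0 : ∀ i, 0 ≤ χ i := fun i => by simp only [χ]; split_ifs <;> simp
  have hχ1 : ∀ i, 0 ≤ 1 - χ i := fun i => by simp only [χ]; split_ifs <;> simp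
  -- The spectral projection of `A ⊙ C` onto its first `k` eigenvectors; its trace against `A ⊙ C`
  -- is the sum to be bounded.
  set P := U' * diagonal χ * U'ᴴ
  have hP0 : P.PosSemidef := (PosSemidef.diagonal hχ0).mul_mul_conjTranspose_same U'
  have hP1 : (1 - P).PosSemidef := by
    have : 1 - P = U' * diagonal (fun i => 1 - χ i) * U'ᴴ := by
      rw [← diagonal_sub, diagonal_one, mul_sub, sub_mul, mul_one, h'.mul_star]
    rw [this]
    exact (PosSemidef.diagonal hχ1).mul_mul_conjTranspose_same U'
  -- Hadamard multiplication moves to the other factor: `tr (P (A ⊙ C)) = tr (Q A)`. The Schur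
  -- product theorem and the unit diagonal of `C` give `0 ≤ Q ≤ 1` and `tr Q = tr P`, so the
  -- diagonal of `Uᴴ Q U` is an admissible set of weights for the eigenvalues of `A`.
  set Q := P ⊙ Cᵀ
  have hQ0 : (Uᴴ * Q * U).PosSemidef := (hP0.hadamard hC.transpose).conjTranspose_mul_mul_same U
  have hQ1 : (1 - Uᴴ * Q * U).PosSemidef := by
    have e : 1 - Uᴴ * Q * U = Uᴴ * ((1 - P) ⊙ Cᵀ) * U := by
      have : (1 - P) ⊙ Cᵀ = 1 - Q := by
        ext i j
        by_cases hij : i = j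
        · subst hij; simp [Q, hC1]
        · simp [Q, hij]
      rw [this, mul_sub, sub_mul, mul_one, h.star_mul]
    rw [e]
    exact (hP1.hadamard hC.transpose).conjTranspose_mul_mul_same U
  have htr : (Uᴴ * Q * U).trace = ∑ i, χ i := by
    rw [mul_assoc, trace_mul_comm, mul_assoc, h.mul_star, mul_one]
    have : Q.trace = P.trace := by simp [trace, Q, hC1]
    rw [this, trace_mul_comm, ← mul_assoc, h'.star_mul, one_mul, trace_diagonal]
  have hl' : ∑ i : Fin M, (if (i : ℕ) < k then (l' i : ℂ) else 0) = (P * (A ⊙ C)).trace := by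
    have : P * (A ⊙ C) = U' * (diagonal χ * diagonal fun i => (l' i : ℂ)) * U'ᴴ := by
      rw [h'.eq]
      simp only [P, mul_assoc]
      rw [← mul_assoc U'ᴴ U', h'.star_mul, one_mul]
    rw [this, trace_mul_comm, ← mul_assoc, h'.star_mul, one_mul, diagonal_mul_diagonal,
      trace_diagonal]
    simp [χ]
  have hl : (P * (A ⊙ C)).trace = ∑ i, (l i : ℂ) * (Uᴴ * Q * U) i i := by
    have e1 : (P * (A ⊙ C)).trace = (Q * A).trace := by
      simp only [trace, diag_apply, mul_apply, Q, hadamard_apply, transpose_apply]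
      refine Finset.sum_congr rfl fun i _ => Finset.sum_congr rfl fun j _ => by ring
    have e2 : (Q * A).trace = ((Uᴴ * Q * U) * diagonal fun i => (l i : ℂ)).trace := by
      conv_lhs => rw [h.eq, ← mul_assoc, trace_mul_comm]
      simp only [mul_assoc]
    rw [e1, e2]
    simp [trace, mul_diagonal, mul_comm]
  have key := sum_mul_le_sum_ite_of_antitone (q := fun i => ((Uᴴ * Q * U) i i).re) h.antitone k
    (fun i => (Complex.le_def.1 (hQ0.diag_nonneg (i := i))).1)
    (fun i => by
      have := (Complex.le_def.1 (hQ1.diag_nonneg (i := i))).1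
      simp only [Matrix.sub_apply, one_apply_eq, Complex.zero_re, Complex.sub_re, Complex.one_re] at this
      linarith)
    (by
      have := congrArg Complex.re htr
      simp only [trace, diag_apply, Complex.re_sum, χ] at this
      rw [this]
      refine Finset.sum_congr rfl fun i _ => by split_ifs <;> simp)
  refine le_trans (le_of_eq ?_) key
  have := congrArg Complex.re (hl'.trans hl)
  simp only [Complex.re_sum, Complex.re_ofReal_mul] at this
  rw [← this]
  refine Finset.sum_congr rfl fun i _ => by split_ifs <;> simp

/-! ### The correlation matrices and the Birman–Schwinger matrices. -/

/-- The matrix `q ^ |m - n|`. -/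
noncomputable def corrMatrix (M : ℕ) (q : ℝ) : Matrix (Fin M) (Fin M) ℂ :=
  Matrix.of fun m n => ((q ^ ((m - n : ℕ) + (n - m : ℕ)) : ℝ) : ℂ)

/-- The lower triangular matrix `q ^ (m - i)`, `i ≤ m`. -/
noncomputable def lowerMatrix (M : ℕ) (q : ℝ) : Matrix (Fin M) (Fin M) ℂ :=
  Matrix.of fun m i => ((if i ≤ m then q ^ (m - i : ℕ) else 0 : ℝ) : ℂ)

theorem sum_fin_ite_le_pow (M : ℕ) (q : ℝ) (m : Fin M) :
    (1 - q ^ 2) * ∑ i : Fin M, (if i ≤ m then (q ^ 2) ^ (m - i : ℕ) else 0)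
      = 1 - q ^ (2 * ((m : ℕ) + 1)) := by
  have h1 : ∑ i : Fin M, (if i ≤ m then (q ^ 2) ^ (m - i : ℕ) else 0)
      = ∑ i ∈ Finset.range ((m : ℕ) + 1), (q ^ 2) ^ ((m : ℕ) - i) := by
    simp only [Fin.le_def]
    rw [Fin.sum_univ_eq_sum_range (fun i => if i ≤ (m : ℕ) then (q ^ 2) ^ ((m : ℕ) - i) else 0),
      ← Finset.sum_filter]
    refine Finset.sum_congr ?_ fun _ _ => rfl
    ext i
    simp only [Finset.mem_filter, Finset.mem_range]
    omega
  have h2 := Finset.sum_range_reflect (fun i => (q ^ 2) ^ i) ((m : ℕ) + 1)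
  rw [Nat.add_sub_cancel] at h2
  rw [h1, h2, mul_neg_geom_sum, pow_mul]

/-- A geometric sum. The first term is the covariance of the autoregression `x (n+1) = q x n +
noise` started from zero, which is the Dirichlet Green function at the integers up to a factor; the
second is the rank-one contribution of a stationary start. -/
theorem pow_absDiff_eq {M : ℕ} (q : ℝ) (m n : Fin M) :
    q ^ ((m - n : ℕ) + (n - m : ℕ)) =
      (1 - q ^ 2) * ∑ i : Fin M, (if i ≤ m then q ^ (m - i : ℕ) else 0) *
        (if i ≤ n then q ^ (n - i : ℕ) else 0) + q ^ ((m : ℕ) + 1) * q ^ ((n : ℕ) + 1) := by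
  wlog hmn : m ≤ n generalizing m n
  · rw [add_comm, this n m (le_of_not_ge hmn), mul_comm (q ^ ((m : ℕ) + 1))]
    simp only [mul_comm]
  have hmn' : (m : ℕ) ≤ n := hmn
  have h1 : ∑ i : Fin M, (if i ≤ m then q ^ (m - i : ℕ) else 0) *
      (if i ≤ n then q ^ (n - i : ℕ) else 0)
      = q ^ (n - m : ℕ) * ∑ i : Fin M, (if i ≤ m then (q ^ 2) ^ (m - i : ℕ) else 0) := by
    rw [Finset.mul_sum]
    refine Finset.sum_congr rfl fun i _ => ?_
    by_cases hi : i ≤ m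
    · have hi' : (i : ℕ) ≤ m := hi
      rw [if_pos hi, if_pos hi, if_pos (hi.trans hmn), ← pow_mul, ← pow_add, ← pow_add]
      congr 1
      omega
    · simp [hi]
  rw [h1, mul_left_comm, sum_fin_ite_le_pow, mul_sub, mul_one, ← pow_add, ← pow_add]
  have e1 : (m - n : ℕ) + (n - m : ℕ) = n - m := by omega
  have e2 : (n - m : ℕ) + 2 * ((m : ℕ) + 1) = m + 1 + (n + 1) := by omega
  rw [e1, e2]
  ring

theorem corrMatrix_eq (M : ℕ) (q : ℝ) :
    corrMatrix M q = ((1 - q ^ 2 : ℝ) : ℂ) • (lowerMatrix M q * (lowerMatrix M q)ᴴ) +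
      vecMulVec (fun m : Fin M => ((q ^ ((m : ℕ) + 1) : ℝ) : ℂ))
        (star fun m : Fin M => ((q ^ ((m : ℕ) + 1) : ℝ) : ℂ)) := by
  ext m n
  rw [corrMatrix, of_apply, pow_absDiff_eq]
  simp only [Matrix.add_apply, Matrix.smul_apply, mul_apply, lowerMatrix, conjTranspose_apply,
    of_apply, vecMulVec_apply, Pi.star_apply, smul_eq_mul, RCLike.star_def, Complex.conj_ofReal]
  push_cast
  rfl

theorem corrMatrix_posSemidef (M : ℕ) {q : ℝ} (hq0 : 0 ≤ q) (hq1 : q ≤ 1) :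
    (corrMatrix M q).PosSemidef := by
  rw [corrMatrix_eq]
  refine ((posSemidef_self_mul_conjTranspose _).smul ?_).add (posSemidef_vecMulVec_self_star _)
  rw [Complex.zero_le_real]
  nlinarith

/-- The Birman--Schwinger matrix `√(W m) q ^ |m - n| √(W n)`. -/
noncomputable def bsMatrix {M : ℕ} (W : Fin M → ℝ) (q : ℝ) : Matrix (Fin M) (Fin M) ℂ :=
  Matrix.of fun m n => (√(W m) : ℂ) * corrMatrix M q m n * (√(W n) : ℂ)

/-- This semigroup property in `q` lets Birman–Schwinger matrices at different energies be compared
by `IsSortedDiagonalization.sum_hadamard_le`. -/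
theorem bsMatrix_hadamard {M : ℕ} (W : Fin M → ℝ) (q r : ℝ) :
    bsMatrix W q ⊙ corrMatrix M r = bsMatrix W (q * r) := by
  ext m n
  simp only [bsMatrix, corrMatrix, hadamard_apply, of_apply, mul_pow]
  push_cast
  ring

theorem bsMatrix_posSemidef {M : ℕ} (W : Fin M → ℝ) {q : ℝ} (hq0 : 0 ≤ q) (hq1 : q ≤ 1) :
    (bsMatrix W q).PosSemidef := by
  have : bsMatrix W q = diagonal (fun m => (√(W m) : ℂ)) * corrMatrix M q *
      (diagonal (fun m => (√(W m) : ℂ)))ᴴ := by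
    ext m n
    rw [diagonal_conjTranspose, mul_diagonal, diagonal_mul]
    simp [bsMatrix]
  rw [this]
  exact (corrMatrix_posSemidef M hq0 hq1).mul_mul_conjTranspose_same _

theorem re_trace_bsMatrix {M : ℕ} {W : Fin M → ℝ} (hW : ∀ m, 0 ≤ W m) (q : ℝ) :
    (bsMatrix W q).trace.re = ∑ m, W m := by
  simp only [trace, diag_apply, Complex.re_sum, bsMatrix, of_apply, corrMatrix]
  refine Finset.sum_congr rfl fun m _ => ?_
  rw [← Complex.ofReal_mul, ← Complex.ofReal_mul, Complex.ofReal_re]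
  simp [Real.mul_self_sqrt (hW m)]

/-! ### Min-max and the induction over eigenvalues. -/

theorem IsSortedDiagonalization.re_dotProduct {M : ℕ} {A U : Matrix (Fin M) (Fin M) ℂ}
    {l : Fin M → ℝ} (h : IsSortedDiagonalization A U l) (b : Fin M → ℂ) :
    (star b ⬝ᵥ A *ᵥ b).re = ∑ i, l i * ‖(Uᴴ *ᵥ b) i‖ ^ 2 := by
  have e : star b ⬝ᵥ A *ᵥ b = star (Uᴴ *ᵥ b) ⬝ᵥ (diagonal (fun i => (l i : ℂ)) *ᵥ (Uᴴ *ᵥ b)) := by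
    rw [star_mulVec, conjTranspose_conjTranspose, ← dotProduct_mulVec, mulVec_mulVec,
      mulVec_mulVec, ← h.eq]
  rw [e]
  simp only [dotProduct, mulVec_diagonal, Pi.star_apply, RCLike.star_def, Complex.re_sum]
  refine Finset.sum_congr rfl fun i _ => ?_
  rw [mul_left_comm, Complex.re_ofReal_mul, mul_comm (conj _), Complex.mul_conj,
    Complex.ofReal_re, Complex.normSq_eq_norm_sq]

theorem IsSortedDiagonalization.sum_norm_sq {M : ℕ} {A U : Matrix (Fin M) (Fin M) ℂ}
    {l : Fin M → ℝ} (h : IsSortedDiagonalization A U l) (b : Fin M → ℂ) :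
    ∑ i, ‖(Uᴴ *ᵥ b) i‖ ^ 2 = ∑ i, ‖b i‖ ^ 2 := by
  have e (c : Fin M → ℂ) : ((∑ i, ‖c i‖ ^ 2 : ℝ) : ℂ) = star c ⬝ᵥ c := by
    simp only [dotProduct, Pi.star_apply, RCLike.star_def, mul_comm (conj _), Complex.mul_conj,
      Complex.normSq_eq_norm_sq]
    push_cast
    rfl
  have : ((∑ i, ‖(Uᴴ *ᵥ b) i‖ ^ 2 : ℝ) : ℂ) = ((∑ i, ‖b i‖ ^ 2 : ℝ) : ℂ) := by
    rw [e, e, star_mulVec, conjTranspose_conjTranspose, ← dotProduct_mulVec, mulVec_mulVec,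
      h.mul_star, one_mulVec]
  exact_mod_cast this

/-- Min-max lower bound for the `k`-th eigenvalue (counting from zero) by `k + 1` independent
test vectors. -/
theorem IsSortedDiagonalization.exists_le {M N : ℕ} {A U : Matrix (Fin M) (Fin M) ℂ}
    {l : Fin M → ℝ} (h : IsSortedDiagonalization A U l) {T : Fin N → Fin M → ℂ}
    (hT : LinearIndependent ℂ T) (k : Fin N) {α : ℝ}
    (hα : ∀ c : Fin N → ℂ, (∀ i, k < i → c i = 0) →
      α * ∑ m, ‖(∑ i, c i • T i) m‖ ^ 2 ≤
        (star (∑ i, c i • T i) ⬝ᵥ A *ᵥ (∑ i, c i • T i)).re) :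
    ∃ hk : (k : ℕ) < M, α ≤ l ⟨k, hk⟩ := by
  -- a nonzero combination orthogonal to the first `k` eigenvectors
  let e : ({i : Fin N // i ≤ k} → ℂ) → Fin N → ℂ := fun c i => if hi : i ≤ k then c ⟨i, hi⟩ else 0
  -- The first `k` eigencoordinates as a map from a space of dimension `k + 1`, so its kernel is
  -- nontrivial. Coordinates beyond `M` are set to zero; that `k < M` is deduced afterwards.
  let F : ({i : Fin N // i ≤ k} → ℂ) →ₗ[ℂ] (Fin k → ℂ) :=
    { toFun := fun c j => if hj : (j : ℕ) < M then
        (Uᴴ *ᵥ ∑ i : {i : Fin N // i ≤ k}, c i • T i) ⟨j, hj⟩ else 0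
      map_add' := fun c d => by
        ext j
        simp only [Pi.add_apply, add_smul, Finset.sum_add_distrib, mulVec_add]
        split_ifs <;> simp
      map_smul' := fun a c => by
        ext j
        simp only [Pi.smul_apply, smul_assoc, ← Finset.smul_sum, mulVec_smul, RingHom.id_apply]
        split_ifs <;> simp }
  have hdim : Module.finrank ℂ (Fin k → ℂ) < Module.finrank ℂ ({i : Fin N // i ≤ k} → ℂ) := by
    rw [Module.finrank_fintype_fun_eq_card, Module.finrank_fintype_fun_eq_card, Fintype.card_fin]
    have : Fintype.card {i : Fin N // i ≤ k} = k + 1 := by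
      rw [Fintype.card_subtype]
      have : (Finset.univ.filter fun i : Fin N => i ≤ k) = Finset.Iic k := by ext; simp
      rw [this, Fin.card_Iic]
    omega
  obtain ⟨c, hc, hc0⟩ := Submodule.exists_mem_ne_zero_of_ne_bot
    (LinearMap.ker_ne_bot_of_finrank_lt (f := F) hdim)
  have hsum : ∑ i, e c i • T i = ∑ i : {i : Fin N // i ≤ k}, c i • T i := by
    have : ∑ i : {i : Fin N // i ≤ k}, c i • T i
        = ∑ i : {i : Fin N // i ≤ k}, e c i • T i := by
      refine Finset.sum_congr rfl fun i _ => ?_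
      simp only [e, dif_pos i.2]
    rw [this, ← Finset.sum_subtype (Finset.univ.filter (· ≤ k)) (by simp) fun i => e c i • T i,
      Finset.sum_filter_of_ne]
    intro i _ hi
    by_contra h
    exact hi (by simp only [e, dif_neg h, zero_smul])
  set b := ∑ i, e c i • T i with hb
  have hb0 : b ≠ 0 := by
    intro h0
    refine hc0 (funext fun i => ?_)
    have := Fintype.linearIndependent_iff.1 hT (e c) h0 i
    simpa [e, i.2] using this
  have horth : ∀ i : Fin M, (i : ℕ) < k → (Uᴴ *ᵥ b) i = 0 := by
    intro i hi
    have := congrFun (LinearMap.mem_ker.1 hc) ⟨i, hi⟩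
    simpa [F, i.2, ← hsum] using this
  have hpos : 0 < ∑ i, ‖(Uᴴ *ᵥ b) i‖ ^ 2 := by
    rw [h.sum_norm_sq]
    obtain ⟨i, hi⟩ := Function.ne_iff.1 hb0
    exact Finset.sum_pos' (fun _ _ => sq_nonneg _)
      ⟨i, Finset.mem_univ i, pow_pos (norm_pos_iff.2 hi) 2⟩
  have hk : (k : ℕ) < M := by
    by_contra hk
    refine hpos.ne' (Finset.sum_eq_zero fun i _ => ?_)
    rw [horth i (i.2.trans_le (not_lt.1 hk)), norm_zero, zero_pow two_ne_zero]
  refine ⟨hk, ?_⟩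
  have h1 := hα (e c) fun i hi => dif_neg (not_le.2 hi)
  rw [← hb, h.re_dotProduct, ← h.sum_norm_sq] at h1
  have h2 : ∑ i, l i * ‖(Uᴴ *ᵥ b) i‖ ^ 2 ≤ l ⟨k, hk⟩ * ∑ i, ‖(Uᴴ *ᵥ b) i‖ ^ 2 := by
    rw [Finset.mul_sum]
    refine Finset.sum_le_sum fun i _ => ?_
    rcases lt_or_ge (i : ℕ) k with hi | hi
    · simp [horth i hi]
    · exact mul_le_mul_of_nonneg_right (h.antitone (Fin.le_def.2 hi)) (sq_nonneg _)
  exact le_of_mul_le_mul_right (h1.trans h2) hpos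

/-- The Hundertmark--Lieb--Thomas argument for the family of matrices `bsMatrix W q`. -/
theorem sum_le_sum_of_bsMatrix {M N : ℕ} {W : Fin M → ℝ} (hW : ∀ m, 0 ≤ W m) {q α : Fin N → ℝ}
    (hq0 : ∀ j, 0 < q j) (hq1 : ∀ j, q j ≤ 1) (hq : Monotone q) {T : Fin N → Fin M → ℂ}
    (hT : LinearIndependent ℂ T)
    (hα : ∀ k, ∀ c : Fin N → ℂ, (∀ i, k < i → c i = 0) →
      α k * ∑ m, ‖(∑ i, c i • T i) m‖ ^ 2 ≤
        (star (∑ i, c i • T i) ⬝ᵥ bsMatrix W (q k) *ᵥ (∑ i, c i • T i)).re) :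
    ∑ j, α j ≤ ∑ m, W m := by
  -- Keeping `r` free is what makes the induction run: the hypothesis is used at `r = q k`, the
  -- min-max bound adds `α k` there, and Hadamard monotonicity carries all `k + 1` terms from `q k`
  -- up to `r`.
  have key : ∀ k ≤ N, ∀ r : ℝ, r ≤ 1 → 0 < r → (∀ j : Fin N, (j : ℕ) < k → q j ≤ r) →
      ∀ U l, IsSortedDiagonalization (bsMatrix W r) U l →
      (∑ j : Fin N, if (j : ℕ) < k then α j else 0) ≤
        ∑ i : Fin M, if (i : ℕ) < k then l i else 0 := by
    intro k
    induction k with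
    | zero => intros; simp
    | succ k ih =>
      intro hk r hr1 hr0 hr U l h
      let k' : Fin N := ⟨k, hk⟩
      obtain ⟨U', l', h'⟩ := exists_isSortedDiagonalization
        (bsMatrix_posSemidef W (hq0 k').le (hq1 k')).isHermitian
      have h1 := ih (Nat.le_of_succ_le hk) (q k') (hq1 k') (hq0 k')
        (fun j hj => hq (Fin.le_def.2 hj.le)) U' l' h'
      obtain ⟨hkM, h2⟩ := h'.exists_le hT k' (hα k')
      have split {K : ℕ} (hK : k < K) (f : Fin K → ℝ) :
          (∑ j : Fin K, if (j : ℕ) < k + 1 then f j else 0)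
            = (∑ j : Fin K, if (j : ℕ) < k then f j else 0) + f ⟨k, hK⟩ := by
        have : f ⟨k, hK⟩ = ∑ j : Fin K, if j = ⟨k, hK⟩ then f j else 0 := by simp
        rw [this, ← Finset.sum_add_distrib]
        refine Finset.sum_congr rfl fun j _ => ?_
        rcases lt_trichotomy (j : ℕ) k with hj | hj | hj
        · simp [hj, hj.trans (Nat.lt_succ_self k), Fin.ext_iff, hj.ne]
        · simp [hj, Fin.ext_iff]
        · simp [Fin.ext_iff, hj.ne', not_lt.2 hj.le, not_lt.2 (Nat.succ_le_of_lt hj)]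
      have hqr : q k' ≤ r := hr k' (Nat.lt_succ_self k)
      have e : bsMatrix W r ⊙ corrMatrix M (q k' / r) = bsMatrix W (q k') := by
        rw [bsMatrix_hadamard, mul_div_cancel₀ _ hr0.ne']
      have h3 := h.sum_hadamard_le (e ▸ h')
        (corrMatrix_posSemidef M (div_nonneg (hq0 k').le hr0.le) ((div_le_one hr0).2 hqr))
        (fun i => by simp [corrMatrix]) (k + 1)
      refine le_trans ?_ h3
      rw [split hk, split hkM]
      exact add_le_add h1 h2
  have hps := bsMatrix_posSemidef W zero_le_one le_rfl
  obtain ⟨U, l, h⟩ := exists_isSortedDiagonalization hps.isHermitian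
  have h1 := key N le_rfl 1 le_rfl one_pos (fun j _ => hq1 j) U l h
  simp only [Fin.is_lt, if_true] at h1
  have hl : ∀ i, 0 ≤ l i := by
    intro i
    have h2 : (diagonal fun i => (l i : ℂ)) = Uᴴ * bsMatrix W 1 * U := by
      rw [h.eq]
      simp only [mul_assoc, h.star_mul, mul_one]
      rw [← mul_assoc, h.star_mul, one_mul]
    have h3 := (hps.conjTranspose_mul_mul_same U).diag_nonneg (i := i)
    rw [← h2, diagonal_apply_eq] at h3
    exact_mod_cast h3
  calc ∑ j, α j ≤ ∑ i : Fin M, if (i : ℕ) < N then l i else 0 := h1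
    _ ≤ ∑ i, l i := Finset.sum_le_sum fun i _ => by split_ifs <;> simp [hl i]
    _ = (bsMatrix W 1).trace.re := by
      rw [h.eq, trace_mul_comm, ← mul_assoc, h.star_mul, one_mul, trace_diagonal]
      simp
    _ = ∑ m, W m := re_trace_bsMatrix hW 1

end DeltaSchrodinger

/-! ### Energy inequalities on a unit interval. -/

namespace DeltaSchrodinger

/-- `f` is absolutely continuous between `a` and `b` with a.e. derivative `f'`. -/
structure IsPrimitive (f f' : ℝ → ℝ) (a b : ℝ) : Prop where
  ac : AbsolutelyContinuousOnInterval f a b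
  int : IntervalIntegrable f' volume a b
  deriv : ∀ᵐ x, x ∈ uIcc a b → HasDerivAt f (f' x) x

namespace IsPrimitive

variable {f f' g g' : ℝ → ℝ} {a b : ℝ}

theorem integral_eq_sub (h : IsPrimitive f f' a b) : ∫ x in a..b, f' x = f b - f a := by
  rw [← h.ac.integral_deriv_eq_sub]
  refine intervalIntegral.integral_congr_ae ?_
  filter_upwards [h.deriv] with x hx hx'
  exact (hx (uIoc_subset_uIcc hx')).deriv.symm

theorem add (hf : IsPrimitive f f' a b) (hg : IsPrimitive g g' a b) :
    IsPrimitive (fun x => f x + g x) (fun x => f' x + g' x) a b := by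
  refine ⟨hf.ac.add hg.ac, hf.int.add hg.int, ?_⟩
  filter_upwards [hf.deriv, hg.deriv] with x h1 h2 hx
  exact (h1 hx).add (h2 hx)

theorem mul (hf : IsPrimitive f f' a b) (hg : IsPrimitive g g' a b) :
    IsPrimitive (fun x => f x * g x) (fun x => f' x * g x + f x * g' x) a b := by
  refine ⟨hf.ac.fun_mul hg.ac, (hf.int.mul_continuousOn hg.ac.continuousOn).add
    (hg.int.continuousOn_mul hf.ac.continuousOn), ?_⟩
  filter_upwards [hf.deriv, hg.deriv] with x h1 h2 hx
  exact (h1 hx).mul (h2 hx)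

theorem of_contDiff (hf : ContDiff ℝ 1 f) (h : ∀ x, HasDerivAt f (f' x) x) :
    IsPrimitive f f' a b := by
  have e : f' = _root_.deriv f := funext fun x => (h x).deriv.symm
  refine ⟨hf.contDiffOn.absolutelyContinuousOnInterval, ?_, ae_of_all _ fun x _ => h x⟩
  rw [e]
  exact (hf.continuous_deriv le_rfl).intervalIntegrable _ _

theorem of_integral (hf : IntervalIntegrable f' volume 0 b) (ha : 0 ≤ a) (hab : a ≤ b) :
    IsPrimitive (fun x => ∫ t in (0 : ℝ)..x, f' t) f' a b := by
  have hsub : uIcc a b ⊆ uIcc 0 b := by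
    rw [uIcc_of_le hab, uIcc_of_le (ha.trans hab)]
    exact Icc_subset_Icc_left ha
  refine ⟨(hf.absolutelyContinuousOnInterval_intervalIntegral left_mem_uIcc).mono hsub,
    hf.mono_set hsub, ?_⟩
  filter_upwards [hf.ae_hasDerivAt_integral] with x hx hx'
  exact hx (hsub hx') 0 left_mem_uIcc

/-- A lower bound for the energy of a function, localized to a unit interval. -/
theorem mul_sq_le (h : IsPrimitive f f' a (a + 1))
    (h2 : IntervalIntegrable (fun x => f' x ^ 2) volume a (a + 1)) {t : ℝ} (ht0 : 0 ≤ t)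
    (ht8 : t ≤ 8) :
    t / 4 * f (a + 1) ^ 2 ≤ ∫ x in a..(a + 1), (3 / 4 * f' x ^ 2 + t * f x ^ 2) := by
  -- The weight vanishes at the left end and equals `t / 4` at the right, so integrating the
  -- derivative of the weight times `f²` leaves only the value at `a + 1`.
  have hφ : IsPrimitive (fun x => t / 4 * (x - a)) (fun _ => t / 4) a (a + 1) := by
    refine of_contDiff (by fun_prop) fun x => ?_
    simpa using ((hasDerivAt_id x).sub_const a).const_mul (t / 4)
  have hG := hφ.mul (h.mul h)
  have e := hG.integral_eq_sub
  have e' : t / 4 * (a + 1 - a) * (f (a + 1) * f (a + 1)) - t / 4 * (a - a) * (f a * f a)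
      = t / 4 * f (a + 1) ^ 2 := by ring
  rw [← e', ← e]
  refine intervalIntegral.integral_mono_on (by linarith) hG.int ((h2.const_mul _).add
    (((h.ac.continuousOn.pow 2).intervalIntegrable).const_mul t)) fun x hx => ?_
  obtain ⟨s, hs⟩ : ∃ s, s = x - a := ⟨_, rfl⟩
  have hs0 : 0 ≤ s := by linarith [hx.1]
  have hs1 : s ≤ 1 := by linarith [hx.2]
  rw [← hs]
  -- The restriction `t ≤ 8` enters here; it lets the cross term be absorbed by completing the
  -- square.
  have h3 : (t / 4 * s) ^ 2 ≤ t / 2 := by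
    have h4 : (t / 4 * s) ^ 2 ≤ (t / 4) ^ 2 :=
      pow_le_pow_left₀ (by positivity) (mul_le_of_le_one_right (by positivity) hs1) 2
    nlinarith
  nlinarith [sq_nonneg (3 * f' x - 4 * (t / 4 * s) * f x), mul_le_mul_of_nonneg_right h3
    (sq_nonneg (f x)), mul_nonneg ht0 (sq_nonneg (f x))]

/-- Complete the square in `f' + μ f - c E` with `E = exp (μ (x - (a + 1)))`: the cross terms are
exact derivatives. Equality holds when the square vanishes, so the constant is the best one. -/
theorem sq_sub_le (h : IsPrimitive f f' a (a + 1))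
    (h2 : IntervalIntegrable (fun x => f' x ^ 2) volume a (a + 1)) {μ : ℝ} (hμ : 0 < μ) :
    2 * μ / (1 - Real.exp (-μ) ^ 2) * (f (a + 1) - Real.exp (-μ) * f a) ^ 2 ≤
      (∫ x in a..(a + 1), (f' x ^ 2 + μ ^ 2 * f x ^ 2)) + μ * (f (a + 1) ^ 2 - f a ^ 2) := by
  set q := Real.exp (-μ) with hq
  have hq1 : 0 < 1 - q ^ 2 := by
    have h0 : 0 < q := Real.exp_pos _
    have h1 : q < 1 := Real.exp_zero ▸ Real.exp_lt_exp.2 (by linarith)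
    nlinarith
  set d := f (a + 1) - q * f a with hd
  -- The maximizer of `2 c d - c² (1 - q²) / (2 μ)`.
  set c := 2 * μ * d / (1 - q ^ 2) with hc
  have hE : IsPrimitive (fun x => Real.exp (μ * (x - (a + 1))))
      (fun x => μ * Real.exp (μ * (x - (a + 1)))) a (a + 1) := by
    refine of_contDiff (by fun_prop) fun x => ?_
    have := (((hasDerivAt_id x).sub_const (a + 1)).const_mul μ).exp
    simpa [mul_comm] using this
  have hk (r : ℝ) : IsPrimitive (fun _ => r) (fun _ => 0) a (a + 1) :=
    of_contDiff contDiff_const fun x => hasDerivAt_const x r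
  -- The derivative of this combination is `f'² + μ² f² - (f' + μ f - c E)²`.
  have hG := ((hk (-μ)).mul (h.mul h)).add (((hk (2 * c)).mul (hE.mul h)).add
    ((hk (-(c ^ 2 / (2 * μ)))).mul (hE.mul hE)))
  have e := hG.integral_eq_sub
  have hle : ∫ x in a..(a + 1), _ ≤ ∫ x in a..(a + 1), (f' x ^ 2 + μ ^ 2 * f x ^ 2) :=
    intervalIntegral.integral_mono_on (by linarith) hG.int (h2.add
    (((h.ac.continuousOn.pow 2).intervalIntegrable).const_mul (μ ^ 2))) fun x hx => by
      set E := Real.exp (μ * (x - (a + 1)))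
      have h3 : c ^ 2 / (2 * μ) * μ = c ^ 2 / 2 := by field_simp
      nlinarith [sq_nonneg (f' x + μ * f x - c * E)]
  rw [e] at hle
  have e1 : Real.exp (μ * (a + 1 - (a + 1))) = 1 := by simp
  have e2 : Real.exp (μ * (a - (a + 1))) = q := by rw [hq]; congr 1; ring
  simp only [e1, e2] at hle
  have e3 : 2 * μ / (1 - q ^ 2) * d ^ 2
      = 2 * c * d - c ^ 2 / (2 * μ) * (1 - q ^ 2) := by
    rw [hc]
    field_simp
    ring
  rw [e3]
  nlinarith

end IsPrimitive

/-! ### Energy inequalities on the half-line. -/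

namespace IsW012

variable {u u' : ℝ → ℂ}

theorem integrable_norm_sq (h : IsW012 u u') : IntegrableOn (fun x => ‖u x‖ ^ 2) (Ioi 0) :=
  h.memLp.integrable_norm_pow (by norm_num)

theorem integrable_norm_sq_deriv (h : IsW012 u u') :
    IntegrableOn (fun x => ‖u' x‖ ^ 2) (Ioi 0) :=
  h.memLp_deriv.integrable_norm_pow (by norm_num)

theorem apply_zero (h : IsW012 u u') : u 0 = 0 := by
  simpa using h.eq_integral 0 le_rfl

/-- A linear functional applied to `u`, as a primitive. -/
theorem isPrimitive_comp (h : IsW012 u u') (L : ℂ →L[ℝ] ℝ) (n : ℕ) :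
    IsPrimitive (fun x => ∫ t in (0 : ℝ)..x, L (u' t)) (fun x => L (u' x)) n (n + 1) := by
  have hn : (0 : ℝ) ≤ n := Nat.cast_nonneg n
  have hi := h.intervalIntegrable_deriv le_rfl (show (0 : ℝ) ≤ n + 1 by linarith)
  exact IsPrimitive.of_integral ⟨L.integrable_comp hi.1, L.integrable_comp hi.2⟩ hn (by linarith)

theorem comp_eq_integral (h : IsW012 u u') (L : ℂ →L[ℝ] ℝ) {x : ℝ} (hx : 0 ≤ x) :
    ∫ t in (0 : ℝ)..x, L (u' t) = L (u x) := by
  rw [h.eq_integral x hx]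
  exact L.intervalIntegral_comp_comm (h.intervalIntegrable_deriv le_rfl hx)

theorem intervalIntegrable_norm_sq (h : IsW012 u u') (n : ℕ) :
    IntervalIntegrable (fun x => ‖u x‖ ^ 2) volume n (n + 1) := by
  rw [intervalIntegrable_iff_integrableOn_Ioc_of_le (by linarith)]
  exact h.integrable_norm_sq.mono_set fun x hx => lt_of_le_of_lt (Nat.cast_nonneg n) hx.1

theorem intervalIntegrable_norm_sq_deriv (h : IsW012 u u') (n : ℕ) :
    IntervalIntegrable (fun x => ‖u' x‖ ^ 2) volume n (n + 1) := by
  rw [intervalIntegrable_iff_integrableOn_Ioc_of_le (by linarith)]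
  exact h.integrable_norm_sq_deriv.mono_set fun x hx => lt_of_le_of_lt (Nat.cast_nonneg n) hx.1

theorem intervalIntegrable_sq_deriv (h : IsW012 u u') (L : ℂ →L[ℝ] ℝ) (n : ℕ) :
    IntervalIntegrable (fun x => L (u' x) ^ 2) volume n (n + 1) := by
  refine ((h.intervalIntegrable_norm_sq_deriv n).const_mul (‖L‖ ^ 2)).mono_fun' ?_ ?_
  · exact ((L.continuous.comp_aestronglyMeasurable
      (h.intervalIntegrable_deriv (Nat.cast_nonneg n)
        (show (n : ℝ) ≤ n + 1 by linarith)).aestronglyMeasurable_restrict_uIoc).pow 2)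
  · refine ae_of_all _ fun x => ?_
    dsimp only
    rw [norm_pow, ← mul_pow]
    exact pow_le_pow_left₀ (norm_nonneg _) (L.le_opNorm _) 2

/-- Recombines the real-valued interval inequalities, applied to the real and imaginary parts
separately. -/
theorem integral_re_add_im (h : IsW012 u u') (n : ℕ) (r s : ℝ) :
    (∫ x in (n : ℝ)..(n + 1), (r * Complex.reCLM (u' x) ^ 2 +
        s * (∫ t in (0 : ℝ)..x, Complex.reCLM (u' t)) ^ 2)) +
      (∫ x in (n : ℝ)..(n + 1), (r * Complex.imCLM (u' x) ^ 2 +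
        s * (∫ t in (0 : ℝ)..x, Complex.imCLM (u' t)) ^ 2)) =
    ∫ x in (n : ℝ)..(n + 1), (r * ‖u' x‖ ^ 2 + s * ‖u x‖ ^ 2) := by
  have hi (L : ℂ →L[ℝ] ℝ) : IntervalIntegrable (fun x => r * L (u' x) ^ 2 +
        s * (∫ t in (0 : ℝ)..x, L (u' t)) ^ 2) volume n (n + 1) :=
    ((h.intervalIntegrable_sq_deriv L n).const_mul r).add
      ((((h.isPrimitive_comp L n).ac.continuousOn.pow 2).intervalIntegrable).const_mul s)
  rw [← intervalIntegral.integral_add (hi _) (hi _)]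
  refine intervalIntegral.integral_congr fun x hx => ?_
  rw [uIcc_of_le (by linarith)] at hx
  have hx0 : 0 ≤ x := (Nat.cast_nonneg n).trans hx.1
  simp only [h.comp_eq_integral _ hx0]
  simp only [Complex.sq_norm, Complex.normSq_apply, Complex.reCLM_apply,
    Complex.imCLM_apply]
  ring

theorem mul_norm_sq_le (h : IsW012 u u') (n : ℕ) {t : ℝ} (ht0 : 0 ≤ t) (ht8 : t ≤ 8) :
    t / 4 * ‖u (n + 1)‖ ^ 2 ≤ ∫ x in (n : ℝ)..(n + 1), (3 / 4 * ‖u' x‖ ^ 2 + t * ‖u x‖ ^ 2) := by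
  have h1 (L : ℂ →L[ℝ] ℝ) := (h.isPrimitive_comp L n).mul_sq_le
    (h.intervalIntegrable_sq_deriv L n) ht0 ht8
  have h2 := add_le_add (h1 Complex.reCLM) (h1 Complex.imCLM)
  rw [h.integral_re_add_im, h.comp_eq_integral _ (by positivity),
    h.comp_eq_integral _ (by positivity)] at h2
  refine le_trans (le_of_eq ?_) h2
  simp only [Complex.sq_norm, Complex.normSq_apply, Complex.reCLM_apply, Complex.imCLM_apply]
  ring

theorem norm_sub_sq_le (h : IsW012 u u') (n : ℕ) {μ : ℝ} (hμ : 0 < μ) :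
    2 * μ / (1 - Real.exp (-μ) ^ 2) * ‖u (n + 1) - Real.exp (-μ) * u n‖ ^ 2 ≤
      (∫ x in (n : ℝ)..(n + 1), (‖u' x‖ ^ 2 + μ ^ 2 * ‖u x‖ ^ 2)) +
        μ * (‖u (n + 1)‖ ^ 2 - ‖u n‖ ^ 2) := by
  have h1 (L : ℂ →L[ℝ] ℝ) := (h.isPrimitive_comp L n).sq_sub_le
    (h.intervalIntegrable_sq_deriv L n) hμ
  have h2 := add_le_add (h1 Complex.reCLM) (h1 Complex.imCLM)
  have h3 := h.integral_re_add_im n 1 (μ ^ 2)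
  simp only [one_mul] at h3
  rw [add_add_add_comm, h3] at h2
  simp only [h.comp_eq_integral _ (show (0 : ℝ) ≤ n + 1 by positivity),
    h.comp_eq_integral _ (Nat.cast_nonneg n)] at h2
  refine le_trans (le_of_eq ?_) (h2.trans (le_of_eq ?_)) <;>
  · simp only [Complex.sq_norm, Complex.normSq_apply, Complex.reCLM_apply, Complex.imCLM_apply,
      Complex.sub_re, Complex.sub_im, Complex.re_ofReal_mul, Complex.im_ofReal_mul]
    ring

theorem sum_intervalIntegral_le (h : IsW012 u u') {r s : ℝ} (hr : 0 ≤ r) (hs : 0 ≤ s) (N : ℕ) :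
    ∑ n ∈ Finset.range N, ∫ x in (n : ℝ)..(n + 1), (r * ‖u' x‖ ^ 2 + s * ‖u x‖ ^ 2) ≤
      r * (∫ x in Ioi (0 : ℝ), ‖u' x‖ ^ 2) + s * ∫ x in Ioi (0 : ℝ), ‖u x‖ ^ 2 := by
  have hi (n : ℕ) := ((h.intervalIntegrable_norm_sq_deriv n).const_mul r).add
    ((h.intervalIntegrable_norm_sq n).const_mul s)
  have h1 := intervalIntegral.sum_integral_adjacent_intervals (n := N) (a := fun n : ℕ => (n : ℝ))
    (fun n _ => by simpa using hi n)
  simp only [Nat.cast_add, Nat.cast_one, Nat.cast_zero] at h1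
  rw [h1, intervalIntegral.integral_of_le (Nat.cast_nonneg N), ← integral_const_mul,
    ← integral_const_mul, ← integral_add (h.integrable_norm_sq_deriv.const_mul r)
      (h.integrable_norm_sq.const_mul s)]
  refine setIntegral_mono_set ((h.integrable_norm_sq_deriv.const_mul r).add
    (h.integrable_norm_sq.const_mul s)) (ae_of_all _ fun x => ?_)
    Ioc_subset_Ioi_self.eventuallyLE
  simp only [Pi.zero_apply]
  positivity

/-- The shift of the energy absorbed by point interactions of strength `t / 4`. -/
theorem mul_tsum_le (h : IsW012 u u') {t : ℝ} (ht0 : 0 ≤ t) (ht8 : t ≤ 8) :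
    t / 4 * ∑' n : ℕ+, ‖u (n : ℝ)‖ ^ 2 ≤
      3 / 4 * (∫ x in Ioi (0 : ℝ), ‖u' x‖ ^ 2) + t * ∫ x in Ioi (0 : ℝ), ‖u x‖ ^ 2 := by
  rw [← tsum_mul_left]
  have e : ∑' n : ℕ+, t / 4 * ‖u (n : ℝ)‖ ^ 2 = ∑' n : ℕ, t / 4 * ‖u ((n : ℝ) + 1)‖ ^ 2 := by
    rw [← Equiv.tsum_eq Equiv.pnatEquivNat.symm]
    simp [Equiv.pnatEquivNat]
  rw [e]
  refine Real.tsum_le_of_sum_range_le (fun n => by positivity) fun N => ?_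
  exact (Finset.sum_le_sum fun n _ => h.mul_norm_sq_le n ht0 ht8).trans
    (h.sum_intervalIntegral_le (by norm_num) ht0 N)

/-- The energy dominates the inverse of the covariance `exp (-μ |m - n|) / (2 μ)`. -/
theorem sum_norm_sub_sq_le (h : IsW012 u u') {μ : ℝ} (hμ : 0 < μ) (M : ℕ) :
    2 * μ / (1 - Real.exp (-μ) ^ 2) *
        ∑ n ∈ Finset.range M, ‖u (n + 1) - Real.exp (-μ) * u n‖ ^ 2 ≤
      (∫ x in Ioi (0 : ℝ), ‖u' x‖ ^ 2) + μ ^ 2 * ∫ x in Ioi (0 : ℝ), ‖u x‖ ^ 2 := by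
  have hq1 : 0 < 1 - Real.exp (-μ) ^ 2 := by
    have h0 := Real.exp_pos (-μ)
    have h1 : Real.exp (-μ) < 1 := Real.exp_zero ▸ Real.exp_lt_exp.2 (by linarith)
    nlinarith
  set I := (∫ x in Ioi (0 : ℝ), ‖u' x‖ ^ 2) + μ ^ 2 * ∫ x in Ioi (0 : ℝ), ‖u x‖ ^ 2 with hI
  -- Summing over unit intervals telescopes the boundary terms, using `u 0 = 0`. The remainder `μ ‖u
  -- N‖²` disappears as `N → ∞`, since the point values are square summable.
  have key : ∀ N ≥ M, 2 * μ / (1 - Real.exp (-μ) ^ 2) *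
        ∑ n ∈ Finset.range M, ‖u (n + 1) - Real.exp (-μ) * u n‖ ^ 2 ≤ I + μ * ‖u N‖ ^ 2 := by
    intro N hN
    have h1 := Finset.sum_le_sum fun n (_ : n ∈ Finset.range N) => h.norm_sub_sq_le n hμ
    have h2 := h.sum_intervalIntegral_le zero_le_one (sq_nonneg μ) N
    simp only [one_mul] at h2
    have h3 := Finset.sum_range_sub (fun n : ℕ => ‖u n‖ ^ 2) N
    simp only [Nat.cast_add, Nat.cast_one, Nat.cast_zero, h.apply_zero] at h3
    rw [Finset.sum_add_distrib, ← Finset.mul_sum, ← Finset.mul_sum, h3] at h1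
    have h4 : ∑ n ∈ Finset.range M, ‖u (n + 1) - Real.exp (-μ) * u n‖ ^ 2 ≤
        ∑ n ∈ Finset.range N, ‖u (n + 1) - Real.exp (-μ) * u n‖ ^ 2 :=
      Finset.sum_le_sum_of_subset_of_nonneg (Finset.range_subset_range.2 hN)
        fun _ _ _ => sq_nonneg _
    have h5 := mul_le_mul_of_nonneg_left h4 (show 0 ≤ 2 * μ / (1 - Real.exp (-μ) ^ 2) by positivity)
    simp only [norm_zero, zero_pow two_ne_zero, sub_zero] at h1
    linarith
  have hlim : Filter.Tendsto (fun N : ℕ => I + μ * ‖u N‖ ^ 2) Filter.atTop (nhds (I + μ * 0)) := by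
    refine Filter.Tendsto.const_add _ (Filter.Tendsto.const_mul _ ?_)
    have h1 := (Equiv.summable_iff Equiv.pnatEquivNat.symm).2 h.summable_norm_sq
    have h2 := h1.tendsto_atTop_zero
    rw [← Filter.tendsto_add_atTop_iff_nat 1]
    refine h2.congr fun n => ?_
    simp [Equiv.pnatEquivNat]
  rw [mul_zero, add_zero] at hlim
  exact ge_of_tendsto hlim (Filter.eventually_atTop.2 ⟨M, key⟩)

end IsW012

end DeltaSchrodinger

/-! ### The Birman–Schwinger bound and the form on eigenfunctions. -/

namespace DeltaSchrodinger

section Matrix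

open Matrix
open scoped ComplexOrder

/-- The lower triangular matrix inverts the recursion `x ↦ x (n+1) - q x n`; the Dirichlet value `x
0 = 0` removes the initial term. -/
theorem lowerMatrix_mulVec {M : ℕ} (q : ℝ) {x : ℕ → ℂ} (hx : x 0 = 0) (m : Fin M) :
    (lowerMatrix M q *ᵥ fun i : Fin M => x (i + 1) - q * x i) m = x (m + 1) := by
  have key : ∀ k : ℕ, ∑ i ∈ Finset.range (k + 1), (q : ℂ) ^ (k - i) * (x (i + 1) - q * x i)
      = x (k + 1) := by
    intro k
    induction k with
    | zero => simp [hx]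
    | succ k ih =>
      rw [Finset.sum_range_succ]
      have : ∑ i ∈ Finset.range (k + 1), (q : ℂ) ^ (k + 1 - i) * (x (i + 1) - q * x i)
          = q * ∑ i ∈ Finset.range (k + 1), (q : ℂ) ^ (k - i) * (x (i + 1) - q * x i) := by
        rw [Finset.mul_sum]
        refine Finset.sum_congr rfl fun i hi => ?_
        rw [Nat.sub_add_comm (Nat.lt_succ_iff.1 (Finset.mem_range.1 hi)), pow_succ]
        ring
      rw [this, ih]
      simp
  rw [← key m]
  simp only [mulVec, dotProduct, lowerMatrix, of_apply, Fin.le_def]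
  rw [Fin.sum_univ_eq_sum_range (fun i => ((if i ≤ (m : ℕ) then q ^ ((m : ℕ) - i) else 0 : ℝ) : ℂ) *
    (x (i + 1) - q * x i)) M]
  symm
  rw [← Finset.sum_subset (Finset.range_subset_range.2 m.2)]
  · refine Finset.sum_congr rfl fun i hi => ?_
    rw [if_pos (Nat.lt_succ_iff.1 (Finset.mem_range.1 hi))]
    push_cast
    rfl
  · intro i _ hi
    rw [if_neg (by simpa [Nat.lt_succ_iff] using hi)]
    simp

theorem sum_norm_sq_eq_re {M : ℕ} (c : Fin M → ℂ) : ∑ i, ‖c i‖ ^ 2 = (star c ⬝ᵥ c).re := by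
  simp only [dotProduct, Pi.star_apply, RCLike.star_def, mul_comm (conj _), Complex.mul_conj,
    Complex.normSq_eq_norm_sq, Complex.re_sum, Complex.ofReal_re]

/-- The Birman--Schwinger bound: a sequence whose weighted norm exceeds its energy is a test vector
for the Birman--Schwinger matrix. -/
theorem le_re_dotProduct_bsMatrix {M : ℕ} {W : Fin M → ℝ} (hW : ∀ m, 0 ≤ W m) {q : ℝ}
    (hq0 : 0 ≤ q) (hq1 : q < 1) {x : ℕ → ℂ} (hx : x 0 = 0) {c : ℝ} (hc : 0 ≤ c)
    (hE : c / (1 - q ^ 2) * ∑ n ∈ Finset.range M, ‖x (n + 1) - q * x n‖ ^ 2 ≤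
      ∑ m, W m * ‖x (m + 1)‖ ^ 2) {b : Fin M → ℂ} (hb : ∀ m, b m = √(W m) * x (m + 1)) :
    c * ∑ m, ‖b m‖ ^ 2 ≤ (star b ⬝ᵥ bsMatrix W q *ᵥ b).re := by
  have hq : 0 < 1 - q ^ 2 := by nlinarith
  have hB : ∑ m, ‖b m‖ ^ 2 = ∑ m, W m * ‖x (m + 1)‖ ^ 2 := by
    refine Finset.sum_congr rfl fun m _ => ?_
    rw [hb, norm_mul, mul_pow, Complex.norm_real, Real.norm_eq_abs, sq_abs, Real.sq_sqrt (hW m)]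
  rw [hB]
  set B := ∑ m, W m * ‖x (m + 1)‖ ^ 2
  set a : Fin M → ℂ := fun m => √(W m) * b m
  set R := lowerMatrix M q
  set d : Fin M → ℂ := fun i => x (i + 1) - q * x i with hd
  set y := Rᴴ *ᵥ a
  have hRd : R *ᵥ d = fun m : Fin M => x (m + 1) := funext fun m => lowerMatrix_mulVec q hx m
  have hBy : (B : ℂ) = star y ⬝ᵥ d := by
    rw [star_mulVec, conjTranspose_conjTranspose, ← dotProduct_mulVec, hRd]
    simp only [dotProduct, B, a, hb, Pi.star_apply, RCLike.star_def, map_mul, Complex.conj_ofReal]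
    push_cast
    refine Finset.sum_congr rfl fun m _ => ?_
    rw [← mul_assoc, mul_assoc, mul_comm (conj _), Complex.mul_conj, ← Complex.ofReal_mul,
      Real.mul_self_sqrt (hW m), Complex.normSq_eq_norm_sq]
    push_cast
    rfl
  -- Cauchy–Schwarz for `B = ⟨Rᴴ a, d⟩`: the energy controls `d`, and the Birman–Schwinger form
  -- controls `Rᴴ a`.
  have hCS : B ^ 2 ≤ (∑ i, ‖y i‖ ^ 2) * ∑ i, ‖d i‖ ^ 2 := by
    have h1 : |B| ≤ ∑ i, ‖y i‖ * ‖d i‖ := by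
      rw [← Real.norm_eq_abs, ← Complex.norm_real, hBy]
      refine (norm_sum_le _ _).trans (le_of_eq (Finset.sum_congr rfl fun i _ => ?_))
      rw [norm_mul, Pi.star_apply, norm_star]
    calc B ^ 2 = |B| ^ 2 := (sq_abs B).symm
      _ ≤ (∑ i, ‖y i‖ * ‖d i‖) ^ 2 := pow_le_pow_left₀ (abs_nonneg B) h1 2
      _ ≤ _ := Finset.sum_mul_sq_le_sq_mul_sq _ _ _
  have hform : (1 - q ^ 2) * ∑ i, ‖y i‖ ^ 2 ≤ (star b ⬝ᵥ bsMatrix W q *ᵥ b).re := by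
    have e1 : star b ⬝ᵥ bsMatrix W q *ᵥ b = star a ⬝ᵥ corrMatrix M q *ᵥ a := by
      simp only [dotProduct, mulVec, bsMatrix, of_apply, a, Pi.star_apply, RCLike.star_def,
        map_mul, Complex.conj_ofReal, Finset.mul_sum]
      refine Finset.sum_congr rfl fun i _ => Finset.sum_congr rfl fun j _ => by ring
    have e2 : star a ⬝ᵥ (R * Rᴴ) *ᵥ a = star y ⬝ᵥ y := by
      rw [star_mulVec, conjTranspose_conjTranspose, ← dotProduct_mulVec, mulVec_mulVec]
    rw [e1, corrMatrix_eq, add_mulVec, dotProduct_add, smul_mulVec, dotProduct_smul, e2,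
      Complex.add_re, smul_eq_mul, Complex.re_ofReal_mul, ← sum_norm_sq_eq_re]
    -- The rank-one part of `corrMatrix` is nonnegative and is discarded; only the Dirichlet part is
    -- needed.
    have h3 := (posSemidef_vecMulVec_self_star
      (fun m : Fin M => ((q ^ ((m : ℕ) + 1) : ℝ) : ℂ))).dotProduct_mulVec_nonneg a
    have h4 := (Complex.le_def.1 h3).1
    rw [Complex.zero_re] at h4
    linarith
  have hd2 : ∑ i, ‖d i‖ ^ 2 = ∑ n ∈ Finset.range M, ‖x (n + 1) - q * x n‖ ^ 2 :=
    Fin.sum_univ_eq_sum_range (fun n => ‖x (n + 1) - q * x n‖ ^ 2) M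
  rw [← hd2, div_mul_eq_mul_div, div_le_iff₀ hq] at hE
  have hB0 : 0 ≤ B := Finset.sum_nonneg fun m _ => mul_nonneg (hW m) (sq_nonneg _)
  have hy0 : 0 ≤ ∑ i, ‖y i‖ ^ 2 := Finset.sum_nonneg fun i _ => sq_nonneg _
  refine le_trans ?_ hform
  rcases hB0.eq_or_lt with h0 | h0
  · rw [← h0, mul_zero]
    positivity
  · refine le_of_mul_le_mul_right ?_ h0
    calc c * B * B = c * B ^ 2 := by ring
      _ ≤ c * ((∑ i, ‖y i‖ ^ 2) * ∑ i, ‖d i‖ ^ 2) := mul_le_mul_of_nonneg_left hCS hc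
      _ = (∑ i, ‖y i‖ ^ 2) * (c * ∑ i, ‖d i‖ ^ 2) := by ring
      _ ≤ (∑ i, ‖y i‖ ^ 2) * (B * (1 - q ^ 2)) := mul_le_mul_of_nonneg_left hE hy0
      _ = _ := by ring

end Matrix

theorem IsW012.sum {ι : Type*} (s : Finset ι) {u u' : ι → ℝ → ℂ}
    (h : ∀ i ∈ s, IsW012 (u i) (u' i)) : IsW012 (∑ i ∈ s, u i) (∑ i ∈ s, u' i) := by
  classical
  induction s using Finset.induction_on with
  | empty => simpa using IsW012.zero
  | insert i s hi ih =>
    rw [Finset.sum_insert hi, Finset.sum_insert hi]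
    exact (h i (Finset.mem_insert_self i s)).add
      (ih fun j hj => h j (Finset.mem_insert_of_mem hj))

theorem form_sum (V : lp (fun _ : ℕ+ => ℝ) ∞) {ι : Type*} (s : Finset ι) {u u' : ι → ℝ → ℂ}
    {v v' : ℝ → ℂ} (h : ∀ i ∈ s, IsW012 (u i) (u' i)) (hv : IsW012 v v') :
    form V (∑ i ∈ s, u i) (∑ i ∈ s, u' i) v v' = ∑ i ∈ s, form V (u i) (u' i) v v' := by
  classical
  induction s using Finset.induction_on with
  | empty => simp [form]
  | insert i s hi ih =>
    rw [Finset.sum_insert hi, Finset.sum_insert hi, Finset.sum_insert hi,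
      form_add V (h i (Finset.mem_insert_self i s))
        (IsW012.sum s fun j hj => h j (Finset.mem_insert_of_mem hj)) hv,
      ih fun j hj => h j (Finset.mem_insert_of_mem hj)]

theorem form_self (V : ℕ+ → ℝ) (u u' : ℝ → ℂ) :
    form V u u' u u' = (((∫ x in Ioi (0 : ℝ), ‖u' x‖ ^ 2) +
      ∑' n : ℕ+, V n * ‖u (n : ℝ)‖ ^ 2 : ℝ) : ℂ) := by
  unfold form
  simp only [mul_assoc, Complex.mul_conj, Complex.normSq_eq_norm_sq]
  push_cast
  rw [← integral_complex_ofReal]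
  push_cast
  rfl

theorem inner_eq_integral (f g : L2) {v : ℝ → ℂ} (hv : g =ᵐ[halfLine] v) :
    ∫ x in Ioi (0 : ℝ), f x * conj (v x) = inner ℂ g f := by
  rw [L2.inner_def]
  refine integral_congr_ae ?_
  filter_upwards [hv] with x hx
  rw [← hx, RCLike.inner_apply]

theorem integral_norm_sq_eq (g : L2) {v : ℝ → ℂ} (hv : g =ᵐ[halfLine] v) :
    ∫ x in Ioi (0 : ℝ), ‖v x‖ ^ 2 = ‖g‖ ^ 2 := by
  rw [← inner_self_eq_norm_sq (𝕜 := ℂ) g, ← inner_eq_integral g g hv]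
  have : ∫ x in Ioi (0 : ℝ), g x * conj (v x) = ∫ x in Ioi (0 : ℝ), ((‖v x‖ ^ 2 : ℝ) : ℂ) := by
    refine integral_congr_ae ?_
    filter_upwards [hv] with x hx
    rw [hx, Complex.mul_conj, Complex.normSq_eq_norm_sq]
  rw [this, integral_complex_ofReal]
  rfl

theorem mem_eigenspace_iff_mem_graph (V : lp (fun _ : ℕ+ => ℝ) ∞) (E : ℝ) (f : L2) :
    f ∈ eigenspace (hamiltonian V) E ↔ (f, (E : ℂ) • f) ∈ graph V := by
  rw [← hamiltonian_graph]
  rfl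

theorem exists_of_mem_eigenspace {V : lp (fun _ : ℕ+ => ℝ) ∞} {E : ℝ} {f : L2}
    (hf : f ∈ eigenspace (hamiltonian V) E) : ∃ u u' : ℝ → ℂ, IsW012 u u' ∧ f =ᵐ[halfLine] u ∧
      ∀ (v v' : ℝ → ℂ) (g : L2), IsW012 v v' → g =ᵐ[halfLine] v →
        form V u u' v v' = E * inner ℂ g f := by
  obtain ⟨u, u', hu, hfu, H⟩ := (mem_eigenspace_iff_mem_graph V E f).1 hf
  refine ⟨u, u', hu, hfu, fun v v' g hv hg => ?_⟩
  rw [H v v' hv, inner_eq_integral _ g hg, inner_smul_right]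

theorem form_conj_symm (V : ℕ+ → ℝ) (u u' v v' : ℝ → ℂ) :
    conj (form V u u' v v') = form V v v' u u' := by
  unfold form
  rw [map_add, ← integral_conj, Complex.conj_tsum]
  congr 2
  · ext x
    simp [mul_comm]
  · ext n
    simp only [map_mul, Complex.conj_ofReal, Complex.conj_conj]
    ring

theorem inner_eq_zero_of_mem_eigenspace {V : lp (fun _ : ℕ+ => ℝ) ∞} {E F : ℝ} {f g : L2}
    (hf : f ∈ eigenspace (hamiltonian V) E) (hg : g ∈ eigenspace (hamiltonian V) F)
    (hEF : E ≠ F) : inner ℂ f g = 0 := by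
  obtain ⟨u, u', hu, hfu, hU⟩ := exists_of_mem_eigenspace hf
  obtain ⟨v, v', hv, hgv, hV⟩ := exists_of_mem_eigenspace hg
  have h1 := hU v v' g hv hgv
  have h2 := hV u u' f hu hfu
  rw [← form_conj_symm, h1, map_mul, Complex.conj_ofReal, inner_conj_symm] at h2
  have h3 : ((E : ℂ) - F) * inner ℂ f g = 0 := by rw [sub_mul, h2, sub_self]
  refine (mul_eq_zero.1 h3).resolve_left ?_
  rw [sub_eq_zero]
  exact_mod_cast hEF

/-- The quadratic form on the span of orthonormal eigenfunctions. -/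
theorem exists_eigenfunctions {V : lp (fun _ : ℕ+ => ℝ) ∞} {N : ℕ} {f : Fin N → L2}
    (hf : Orthonormal ℂ f) {e : Fin N → ℝ}
    (he : ∀ i, f i ∈ eigenspace (hamiltonian V) (e i)) :
    ∃ u : Fin N → ℝ → ℂ, ∀ c : Fin N → ℂ, ∃ U', IsW012 (∑ i, c i • u i) U' ∧
      ∫ x in Ioi (0 : ℝ), ‖(∑ i, c i • u i) x‖ ^ 2 = ∑ i, ‖c i‖ ^ 2 ∧
      (∫ x in Ioi (0 : ℝ), ‖U' x‖ ^ 2) + ∑' n : ℕ+, V n * ‖(∑ i, c i • u i) (n : ℝ)‖ ^ 2 =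
        ∑ i, e i * ‖c i‖ ^ 2 := by
  choose u u' hu hfu H using fun i => exists_of_mem_eigenspace (he i)
  refine ⟨u, fun c => ?_⟩
  have hU : IsW012 (∑ i, c i • u i) (∑ i, c i • u' i) := IsW012.sum _ fun i _ => (hu i).smul (c i)
  set g : L2 := ∑ i, c i • f i with hg
  have hgU : g =ᵐ[halfLine] ∑ i, c i • u i := by
    have h1 : g =ᵐ[halfLine] ∑ i, ⇑(c i • f i) := by
      rw [hg]
      exact Lp.coeFn_finsetSum _ _
    refine h1.trans ?_
    have h2 : ∀ᵐ x ∂halfLine, ∀ i, (c i • f i : L2) x = (c i • u i) x := by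
      rw [ae_all_iff]
      exact fun i => (Lp.coeFn_smul (c i) (f i)).trans ((hfu i).const_smul (c i))
    filter_upwards [h2] with x hx
    rw [Finset.sum_apply, Finset.sum_apply]
    exact Finset.sum_congr rfl fun i _ => hx i
  have hgi (i : Fin N) : inner ℂ g (f i) = conj (c i) := by
    rw [hg, hf.inner_left_fintype]
  refine ⟨_, hU, ?_, ?_⟩
  · rw [integral_norm_sq_eq g hgU, ← inner_self_eq_norm_sq (𝕜 := ℂ) g]
    have h1 : inner ℂ g g = ∑ i, ((‖c i‖ ^ 2 : ℝ) : ℂ) := by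
      calc inner ℂ g g = inner ℂ g (∑ i, c i • f i) := rfl
        _ = _ := by
          rw [inner_sum]
          simp only [inner_smul_right, hgi, Complex.mul_conj, Complex.normSq_eq_norm_sq]
    rw [h1, ← Complex.ofReal_sum]
    rfl
  · have h1 := form_sum V Finset.univ (fun i _ => (hu i).smul (c i)) hU
    rw [form_self] at h1
    have h2 (i : Fin N) : form V (c i • u i) (c i • u' i) (∑ i, c i • u i) (∑ i, c i • u' i)
        = ((e i * ‖c i‖ ^ 2 : ℝ) : ℂ) := by
      rw [form_smul, H i _ _ g hU hgU, hgi, mul_left_comm, Complex.mul_conj,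
        Complex.normSq_eq_norm_sq]
      push_cast
      rfl
    simp only [h2] at h1
    exact_mod_cast h1

end DeltaSchrodinger

/-! ### The moment of order `1/2` with a spectral shift. -/

namespace DeltaSchrodinger

theorem summable_mul_norm_sq (V : lp (fun _ : ℕ+ => ℝ) ∞) {u u' : ℝ → ℂ} (hu : IsW012 u u') :
    Summable fun n : ℕ+ => V n * ‖u (n : ℝ)‖ ^ 2 := by
  refine Summable.of_norm_bounded (hu.summable_norm_sq.mul_left ‖V‖) fun n => ?_
  rw [norm_mul, norm_pow, norm_norm]
  exact mul_le_mul_of_nonneg_right (lp.norm_apply_le_norm (by simp) V n) (sq_nonneg _)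

/-- Lower bound of the shifted form by the form with a finitely supported potential. -/
theorem sub_sum_le_form (V : lp (fun _ : ℕ+ => ℝ) ∞) {u u' : ℝ → ℂ} (hu : IsW012 u u') {t : ℝ}
    (ht0 : 0 ≤ t) (ht8 : t ≤ 8) {M : ℕ} {w : ℕ → ℝ}
    (hw : ∀ n : ℕ, -w n ≤ V n.succPNat + t / 4) (hwM : ∀ n, M ≤ n → w n = 0) :
    1 / 4 * (∫ x in Ioi (0 : ℝ), ‖u' x‖ ^ 2) - ∑ m : Fin M, w m * ‖u (m + 1)‖ ^ 2 ≤
      ((∫ x in Ioi (0 : ℝ), ‖u' x‖ ^ 2) + ∑' n : ℕ+, V n * ‖u (n : ℝ)‖ ^ 2) +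
        t * ∫ x in Ioi (0 : ℝ), ‖u x‖ ^ 2 := by
  have h1 := hu.mul_tsum_le ht0 ht8
  have s1 := summable_mul_norm_sq V hu
  have s2 := hu.summable_norm_sq.mul_left (t / 4)
  have h2 : -∑ m : Fin M, w m * ‖u (m + 1)‖ ^ 2 ≤
      ∑' n : ℕ+, (V n * ‖u (n : ℝ)‖ ^ 2 + t / 4 * ‖u (n : ℝ)‖ ^ 2) := by
    have s3 := (Equiv.summable_iff Equiv.pnatEquivNat.symm).2 (s1.add s2)
    rw [← Equiv.tsum_eq Equiv.pnatEquivNat.symm]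
    have e : -∑ m : Fin M, w m * ‖u (m + 1)‖ ^ 2
        = ∑' n : ℕ, -(w n * ‖u ((n : ℝ) + 1)‖ ^ 2) := by
      rw [tsum_eq_sum (s := Finset.range M), Finset.sum_neg_distrib,
        ← Fin.sum_univ_eq_sum_range (fun n => w n * ‖u ((n : ℝ) + 1)‖ ^ 2) M]
      intro n hn
      rw [hwM n (by simpa using hn), zero_mul, neg_zero]
    rw [e]
    refine Summable.tsum_le_tsum (fun n => ?_) ?_ s3
    · have h3 : (((Equiv.pnatEquivNat.symm n : ℕ+) : ℕ) : ℝ) = n + 1 := by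
        simp [Equiv.pnatEquivNat]
      rw [h3, ← add_mul, ← neg_mul]
      exact mul_le_mul_of_nonneg_right (hw n) (sq_nonneg _)
    · refine summable_of_ne_finset_zero (s := Finset.range M) fun n hn => ?_
      rw [hwM n (by simpa using hn), zero_mul, neg_zero]
  rw [s1.tsum_add s2, tsum_mul_left] at h2
  linarith

/-- The Lieb--Thirring inequality with exponent `1/2`, with the spectral shift `t`. -/
theorem sum_sqrt_le_of_monotone {V : lp (fun _ : ℕ+ => ℝ) ∞} {N : ℕ} {f : Fin N → L2}
    (hf : Orthonormal ℂ f) {e : Fin N → ℝ}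
    (he : ∀ i, f i ∈ eigenspace (hamiltonian V) (e i)) (hmono : Monotone e) {t : ℝ}
    (ht0 : 0 ≤ t) (ht8 : t ≤ 8) (het : ∀ i, e i < -t) {M : ℕ} {w : ℕ → ℝ} (hw0 : ∀ n, 0 ≤ w n)
    (hw : ∀ n : ℕ, -w n ≤ V n.succPNat + t / 4) (hwM : ∀ n, M ≤ n → w n = 0) :
    ∑ i, √(-e i - t) ≤ ∑ m : Fin M, w m := by
  obtain ⟨u, H⟩ := exists_eigenfunctions hf he
  -- Multiplying the form by `4` restores the full kinetic energy: the potential becomes `4 w`, and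
  -- the shifted eigenvalue becomes `-μ² = 4 (e + t)`.
  set W : Fin M → ℝ := fun m => 4 * w m with hWdef
  have hW : ∀ m, 0 ≤ W m := fun m => mul_nonneg (by norm_num) (hw0 m)
  set μ : Fin N → ℝ := fun i => 2 * √(-e i - t) with hμdef
  have hμ : ∀ i, 0 < μ i := fun i =>
    mul_pos two_pos (Real.sqrt_pos.2 (by linarith [het i]))
  have hμ2 : ∀ i, μ i ^ 2 = 4 * (-e i - t) := fun i => by
    rw [hμdef, mul_pow, Real.sq_sqrt (by linarith [het i])]
    norm_num
  have hanti : Antitone μ := fun i j hij =>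
    mul_le_mul_of_nonneg_left (Real.sqrt_le_sqrt (by linarith [hmono hij])) two_pos.le
  set T : Fin N → Fin M → ℂ := fun i m => √(W m) * u i (m + 1) with hTdef
  have hTsum (c : Fin N → ℂ) (m : Fin M) :
      (∑ i, c i • T i) m = √(W m) * (∑ i, c i • u i) (m + 1) := by
    simp only [Finset.sum_apply, Pi.smul_apply, hTdef, smul_eq_mul, Finset.mul_sum]
    exact Finset.sum_congr rfl fun i _ => by ring
  have energy (c : Fin N → ℂ) : ∃ U', IsW012 (∑ i, c i • u i) U' ∧
      ∫ x in Ioi (0 : ℝ), ‖(∑ i, c i • u i) x‖ ^ 2 = ∑ i, ‖c i‖ ^ 2 ∧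
      (∫ x in Ioi (0 : ℝ), ‖U' x‖ ^ 2) + 4 * ∑ i, (-e i - t) * ‖c i‖ ^ 2 ≤
        ∑ m, W m * ‖(∑ i, c i • u i) (m + 1)‖ ^ 2 := by
    obtain ⟨U', hU, h1, h2⟩ := H c
    refine ⟨U', hU, h1, ?_⟩
    have h3 := sub_sum_le_form V hU ht0 ht8 hw hwM
    rw [h2, h1] at h3
    simp only [hWdef, mul_assoc, ← Finset.mul_sum, sub_mul, neg_mul, Finset.sum_sub_distrib,
      Finset.sum_neg_distrib]
    linarith
  -- A combination vanishing at all weighted points has no potential energy, so `energy` forces its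
  -- coefficients to vanish because every `-e i - t` is positive.
  have hT : LinearIndependent ℂ T := by
    rw [Fintype.linearIndependent_iff]
    intro c hc
    obtain ⟨U', hU, h1, h2⟩ := energy c
    have h3 : ∑ m, W m * ‖(∑ i, c i • u i) (m + 1)‖ ^ 2 = 0 := by
      refine Finset.sum_eq_zero fun m _ => ?_
      have h4 := hTsum c m
      rw [hc, Pi.zero_apply] at h4
      have h5 : ‖(√(W m) : ℂ) * (∑ i, c i • u i) (m + 1)‖ ^ 2 = 0 := by rw [← h4]; simp
      rwa [norm_mul, mul_pow, Complex.norm_real, Real.norm_eq_abs, sq_abs,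
        Real.sq_sqrt (hW m)] at h5
    have h6 : 0 ≤ ∫ x in Ioi (0 : ℝ), ‖U' x‖ ^ 2 := integral_nonneg fun _ => sq_nonneg _
    have h7 : ∀ i ∈ Finset.univ, 0 ≤ (-e i - t) * ‖c i‖ ^ 2 := fun i _ =>
      mul_nonneg (by linarith [het i]) (sq_nonneg _)
    have h8 := (Finset.sum_eq_zero_iff_of_nonneg h7).1
      (le_antisymm (by linarith) (Finset.sum_nonneg h7))
    intro i
    have h9 := (mul_eq_zero.1 (h8 i (Finset.mem_univ i))).resolve_left (by linarith [het i])
    simpa using h9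
  have main := sum_le_sum_of_bsMatrix hW (q := fun i => Real.exp (-μ i)) (α := fun i => 2 * μ i)
    (fun _ => Real.exp_pos _) (fun i => Real.exp_le_one_iff.2 (by linarith [hμ i]))
    (fun i j hij => Real.exp_le_exp.2 (neg_le_neg (hanti hij))) hT ?_
  · simp only [hWdef, hμdef, ← Finset.mul_sum] at main
    linarith
  intro k c hck
  obtain ⟨U', hU, h1, h2⟩ := energy c
  refine le_re_dotProduct_bsMatrix hW (Real.exp_pos _).le
    (Real.exp_zero ▸ Real.exp_lt_exp.2 (by linarith [hμ k]))
    (x := fun n => (∑ i, c i • u i) (n : ℝ)) (by simpa using hU.apply_zero)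
    (by linarith [hμ k]) ?_ (fun m => by rw [hTsum]; push_cast; rfl)
  have h3 := hU.sum_norm_sub_sq_le (hμ k) M
  -- Only indices `i ≤ k` occur in the combination, and there `e i ≤ e k`; on this span the energy
  -- at level `μ k` is therefore at most the weighted norm.
  have h4 : μ k ^ 2 * ∑ i, ‖c i‖ ^ 2 ≤ 4 * ∑ i, (-e i - t) * ‖c i‖ ^ 2 := by
    rw [hμ2, mul_assoc, Finset.mul_sum]
    refine mul_le_mul_of_nonneg_left (Finset.sum_le_sum fun i _ => ?_) (by norm_num)
    rcases le_or_gt i k with hi | hi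
    · exact mul_le_mul_of_nonneg_right (by linarith [hmono hi]) (sq_nonneg _)
    · simp [hck i hi]
  rw [h1] at h3
  simp only [Nat.cast_add, Nat.cast_one]
  linarith

theorem sum_sqrt_le {V : lp (fun _ : ℕ+ => ℝ) ∞} {ι : Type*} [Fintype ι] {f : ι → L2}
    (hf : Orthonormal ℂ f) {e : ι → ℝ} (he : ∀ i, f i ∈ eigenspace (hamiltonian V) (e i)) {t : ℝ}
    (ht0 : 0 ≤ t) (ht8 : t ≤ 8) {M : ℕ} {w : ℕ → ℝ} (hw0 : ∀ n, 0 ≤ w n)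
    (hw : ∀ n : ℕ, -w n ≤ V n.succPNat + t / 4) (hwM : ∀ n, M ≤ n → w n = 0) :
    ∑ i, √(-e i - t) ≤ ∑ m : Fin M, w m := by
  classical
  -- Eigenvalues at or above `-t` contribute zero, since the real square root vanishes on
  -- nonpositive numbers.
  have h1 : ∑ i, √(-e i - t) = ∑ i : {i // e i < -t}, √(-e i - t) := by
    rw [← Finset.sum_subtype (Finset.univ.filter fun i => e i < -t) (by simp)
      fun i => √(-e i - t), Finset.sum_filter_of_ne]
    intro i _ hi
    by_contra h
    exact hi (Real.sqrt_eq_zero_of_nonpos (by linarith))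
  let σ₀ := (Fintype.equivFin {i // e i < -t}).symm
  let σ := (Tuple.sort fun j => e (σ₀ j)).trans σ₀
  have hσ : Monotone fun j => e (σ j) := Tuple.monotone_sort fun j => e (σ₀ j)
  rw [h1, ← Equiv.sum_comp σ]
  exact sum_sqrt_le_of_monotone
    (hf.comp (fun j => (σ j : ι)) (Subtype.val_injective.comp σ.injective))
    (fun j => he (σ j)) hσ ht0 ht8 (fun j => (σ j).2) hw0 hw hwM

end DeltaSchrodinger

/-! ### Integration over the shift, and the passage to all eigenvalues. -/

namespace DeltaSchrodinger

/-- `ENNReal.ofReal` plays the role of the positive part: beyond `b` the integrand is nonpositive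
and is cut off. The condition `-1 < s` gives integrability at zero. -/
theorem lintegral_rpow_mul_eq {s : ℝ} (hs : -1 < s) {h : ℝ → ℝ} (hc : Continuous h) {b : ℝ}
    (hb : 0 ≤ b) (h0 : ∀ x ∈ Ioc 0 b, 0 ≤ h x) (h1 : ∀ x, b < x → h x ≤ 0) :
    ∫⁻ x in Ioi (0 : ℝ), ENNReal.ofReal (x ^ s * h x) =
      ENNReal.ofReal (∫ x in (0 : ℝ)..b, x ^ s * h x) := by
  have hi : IntervalIntegrable (fun x => x ^ s * h x) volume 0 b :=
    (intervalIntegral.intervalIntegrable_rpow' hs).mul_continuousOn hc.continuousOn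
  rw [intervalIntegral.integral_of_le hb, ofReal_integral_eq_lintegral_ofReal hi.1,
    ← Ioc_union_Ioi_eq_Ioi hb, lintegral_union measurableSet_Ioi
      (Ioc_disjoint_Ioi le_rfl)]
  · rw [setLIntegral_eq_zero measurableSet_Ioi, add_zero]
    intro x hx
    exact ENNReal.ofReal_of_nonpos (mul_nonpos_of_nonneg_of_nonpos
      (Real.rpow_nonneg (hb.trans (le_of_lt hx)) s) (h1 x hx))
  · refine (ae_restrict_iff' measurableSet_Ioc).2 (ae_of_all _ fun x hx => ?_)
    exact mul_nonneg (Real.rpow_nonneg hx.1.le s) (h0 x hx)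

theorem lintegral_rpow_mul_sqrt {p : ℝ} (hp : 1 / 2 < p) {e : ℝ} (he : 0 < e) :
    ∫⁻ x in Ioi (0 : ℝ), ENNReal.ofReal (x ^ (p - 3 / 2) * √(e - x)) =
      ENNReal.ofReal (e ^ p * ∫ γ in (0 : ℝ)..1, (1 - γ) ^ (1 / 2 : ℝ) * γ ^ (p - 3 / 2)) := by
  rw [lintegral_rpow_mul_eq (by linarith) (by fun_prop) he.le (fun _ _ => Real.sqrt_nonneg _)
    (fun x hx => (Real.sqrt_eq_zero_of_nonpos (by linarith)).le)]
  congr 1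
  -- Substituting `x = e γ` gives the power `1 + (p - 3/2) + 1/2 = p`.
  have h1 := intervalIntegral.integral_comp_mul_left (a := 0) (b := 1)
    (fun x => x ^ (p - 3 / 2) * √(e - x)) he.ne'
  rw [mul_zero, mul_one, smul_eq_mul, eq_inv_mul_iff_mul_eq₀ he.ne'] at h1
  rw [← h1, ← intervalIntegral.integral_const_mul, ← intervalIntegral.integral_const_mul]
  refine intervalIntegral.integral_congr fun x hx => ?_
  rw [uIcc_of_le zero_le_one] at hx
  have e1 : e - e * x = e * (1 - x) := by ring
  have e2 : e ^ p = e * (e ^ (p - 3 / 2) * e ^ (1 / 2 : ℝ)) := by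
    rw [← Real.rpow_add he, ← Real.rpow_one_add' he.le (by linarith)]
    congr 1
    ring
  rw [e1, Real.sqrt_eq_rpow, Real.mul_rpow he.le hx.1,
    Real.mul_rpow he.le (sub_nonneg.2 hx.2), e2]
  ring

theorem lintegral_rpow_mul_sub {p : ℝ} (hp : 1 / 2 < p) {v : ℝ} (hv : 0 ≤ v) :
    ∫⁻ x in Ioi (0 : ℝ), ENNReal.ofReal (x ^ (p - 3 / 2) * (v - x / 4)) =
      ENNReal.ofReal (v ^ (p + 1 / 2) *
        ∫ γ in (0 : ℝ)..4, (1 - γ / 4) * γ ^ (p - 3 / 2)) := by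
  rw [lintegral_rpow_mul_eq (b := v * 4) (by linarith) (by fun_prop) (by linarith)
    (fun x hx => by linarith [hx.2]) (fun x hx => by linarith)]
  congr 1
  rcases hv.eq_or_lt with rfl | hv
  · rw [Real.zero_rpow (by linarith), zero_mul, zero_mul, intervalIntegral.integral_same]
  -- Substituting `x = v γ` gives the power `1 + (p - 3/2) + 1 = p + 1/2`.
  have h1 := intervalIntegral.integral_comp_mul_left (a := 0) (b := 4)
    (fun x => x ^ (p - 3 / 2) * (v - x / 4)) hv.ne'
  rw [mul_zero, smul_eq_mul, eq_inv_mul_iff_mul_eq₀ hv.ne'] at h1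
  rw [← h1, ← intervalIntegral.integral_const_mul, ← intervalIntegral.integral_const_mul]
  refine intervalIntegral.integral_congr fun x hx => ?_
  rw [uIcc_of_le (by norm_num)] at hx
  have e2 : v ^ (p + 1 / 2) = v * (v ^ (p - 3 / 2) * v) := by
    rw [← Real.rpow_add_one hv.ne', mul_comm, ← Real.rpow_add_one hv.ne']
    congr 1
    ring
  rw [Real.mul_rpow hv.le hx.1, e2]
  ring

theorem sqrt_integral_pos {p : ℝ} (hp : 1 / 2 < p) :
    0 < ∫ γ in (0 : ℝ)..1, (1 - γ) ^ (1 / 2 : ℝ) * γ ^ (p - 3 / 2) := by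
  refine intervalIntegral.intervalIntegral_pos_of_pos_on ?_ (fun x hx => ?_) one_pos
  · refine (intervalIntegral.intervalIntegrable_rpow' (by linarith)).continuousOn_mul ?_
    exact ((continuous_const.sub continuous_id).rpow_const fun _ => Or.inr (by norm_num)).continuousOn
  · exact mul_pos (Real.rpow_pos_of_pos (by linarith [hx.2]) _) (Real.rpow_pos_of_pos hx.1 _)

theorem linear_integral_nonneg (p : ℝ) :
    0 ≤ ∫ γ in (0 : ℝ)..4, (1 - γ / 4) * γ ^ (p - 3 / 2) :=
  intervalIntegral.integral_nonneg (by norm_num) fun x hx =>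
    mul_nonneg (by linarith [hx.2]) (Real.rpow_nonneg hx.1 _)

theorem summable_rpow {p : ℝ} (hp : 1 / 2 < p) {V : lp (fun _ : ℕ+ => ℝ) ∞}
    (hV : Memℓp (fun n : ℕ+ => V n) (ENNReal.ofReal (p + 1 / 2))) :
    Summable fun n : ℕ+ => |V n| ^ (p + 1 / 2) := by
  have h : (ENNReal.ofReal (p + 1 / 2)).toReal = p + 1 / 2 := ENNReal.toReal_ofReal (by linarith)
  have := (memℓp_gen_iff (by rw [h]; linarith)).1 hV
  simpa only [h, Real.norm_eq_abs] using this

/-- The bound for the moment of order `1/2` of the eigenvalues below `-t`. -/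
theorem sum_ofReal_sqrt_le {p : ℝ} (hp : 1 / 2 < p) {V : lp (fun _ : ℕ+ => ℝ) ∞}
    (hV : Memℓp (fun n : ℕ+ => V n) (ENNReal.ofReal (p + 1 / 2))) (hV2 : ‖V‖ < 2)
    {ι : Type*} [Fintype ι] {f : ι → L2} (hf : Orthonormal ℂ f) {e : ι → ℝ}
    (he : ∀ i, f i ∈ eigenspace (hamiltonian V) (e i)) {t : ℝ} (ht : 0 < t) :
    ∑ i, ENNReal.ofReal √(-e i - t) ≤ ∑' n : ℕ+, ENNReal.ofReal (|V n| - t / 4) := by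
  -- For `t > 8` compare with `t = 8`, where `|V n| - 2 < 0` makes the right side zero: no member of
  -- the family has eigenvalue below `-8`.
  wlog ht8 : t ≤ 8 generalizing t
  · calc ∑ i, ENNReal.ofReal √(-e i - t) ≤ ∑ i, ENNReal.ofReal √(-e i - 8) :=
        Finset.sum_le_sum fun i _ => ENNReal.ofReal_le_ofReal (Real.sqrt_le_sqrt (by linarith))
      _ ≤ ∑' n : ℕ+, ENNReal.ofReal (|V n| - 8 / 4) := this (by norm_num) le_rfl
      _ = 0 := by
        refine ENNReal.tsum_eq_zero.2 fun n => ENNReal.ofReal_of_nonpos ?_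
        have : |V n| ≤ ‖V‖ := lp.norm_apply_le_norm (by simp) V n
        linarith
      _ ≤ _ := zero_le
  have hr : 0 < p + 1 / 2 := by linarith
  obtain ⟨M, hM⟩ : ∃ M : ℕ, ∀ n : ℕ, M ≤ n → |V n.succPNat| ≤ t / 4 := by
    have h1 := ((Equiv.summable_iff Equiv.pnatEquivNat.symm).2
      (summable_rpow hp hV)).tendsto_atTop_zero
    obtain ⟨M, hM⟩ := Filter.eventually_atTop.1
      (h1.eventually_lt_const (Real.rpow_pos_of_pos (show 0 < t / 4 by linarith) (p + 1 / 2)))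
    exact ⟨M, fun n hn => ((Real.rpow_lt_rpow_iff (abs_nonneg _) (by linarith) hr).1 (hM n hn)).le⟩
  have h1 := sum_sqrt_le hf he ht.le ht8 (M := M) (w := fun n => max (|V n.succPNat| - t / 4) 0)
    (fun n => le_max_right _ _)
    (fun n => by
      have h2 := neg_abs_le (V n.succPNat)
      have h3 := le_max_left (|V n.succPNat| - t / 4) 0
      linarith)
    (fun n hn => max_eq_right (by linarith [hM n hn]))
  rw [← ENNReal.ofReal_sum_of_nonneg fun i _ => Real.sqrt_nonneg _]
  refine (ENNReal.ofReal_le_ofReal h1).trans ?_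
  rw [ENNReal.ofReal_sum_of_nonneg fun i _ => le_max_right _ _]
  have h2 (x : ℝ) : ENNReal.ofReal (max x 0) = ENNReal.ofReal x := by
    rw [ENNReal.ofReal_max, ENNReal.ofReal_zero, max_eq_left zero_le]
  simp only [h2]
  rw [Fin.sum_univ_eq_sum_range (fun n => ENNReal.ofReal (|V n.succPNat| - t / 4)) M,
    ← Equiv.tsum_eq Equiv.pnatEquivNat.symm]
  exact ENNReal.sum_le_tsum (Finset.range M)

/-- The Lieb--Thirring inequality for a finite orthonormal family of eigenfunctions. -/
theorem sum_rpow_le {p : ℝ} (hp : 1 / 2 < p) {V : lp (fun _ : ℕ+ => ℝ) ∞}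
    (hV : Memℓp (fun n : ℕ+ => V n) (ENNReal.ofReal (p + 1 / 2))) (hV2 : ‖V‖ < 2)
    {ι : Type*} [Fintype ι] {f : ι → L2} (hf : Orthonormal ℂ f) {e : ι → ℝ}
    (he : ∀ i, f i ∈ eigenspace (hamiltonian V) (e i)) (hneg : ∀ i, e i < 0) :
    ∑ i, |e i| ^ p ≤ ltConst p * ∑' n : ℕ+, |V n| ^ (p + 1 / 2) := by
  have hB := sqrt_integral_pos hp
  have hD := linear_integral_nonneg p
  have hS := summable_rpow hp hV
  unfold ltConst
  set B := ∫ γ in (0 : ℝ)..1, (1 - γ) ^ (1 / 2 : ℝ) * γ ^ (p - 3 / 2)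
  set D := ∫ γ in (0 : ℝ)..4, (1 - γ / 4) * γ ^ (p - 3 / 2)
  have hS0 : 0 ≤ ∑' n : ℕ+, |V n| ^ (p + 1 / 2) :=
    tsum_nonneg fun n => Real.rpow_nonneg (abs_nonneg _) _
  have h1 : ∑ i, ENNReal.ofReal (|e i| ^ p * B) ≤
      ∑' n : ℕ+, ENNReal.ofReal (|V n| ^ (p + 1 / 2) * D) := by
    calc ∑ i, ENNReal.ofReal (|e i| ^ p * B)
        = ∑ i, ∫⁻ x in Ioi (0 : ℝ), ENNReal.ofReal (x ^ (p - 3 / 2) * √(-e i - x)) := by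
          refine Finset.sum_congr rfl fun i _ => ?_
          rw [lintegral_rpow_mul_sqrt hp (neg_pos.2 (hneg i)), abs_of_neg (hneg i)]
      _ = ∫⁻ x in Ioi (0 : ℝ), ∑ i, ENNReal.ofReal (x ^ (p - 3 / 2) * √(-e i - x)) := by
          rw [lintegral_finsetSum]
          intro i _
          fun_prop
      _ ≤ ∫⁻ x in Ioi (0 : ℝ), ∑' n : ℕ+, ENNReal.ofReal (x ^ (p - 3 / 2) * (|V n| - x / 4)) := by
          refine setLIntegral_mono' measurableSet_Ioi fun x hx => ?_
          have hx0 : 0 ≤ x ^ (p - 3 / 2) := Real.rpow_nonneg (le_of_lt hx) _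
          simp only [ENNReal.ofReal_mul hx0]
          rw [← Finset.mul_sum, ENNReal.tsum_mul_left]
          exact mul_le_mul_right (sum_ofReal_sqrt_le hp hV hV2 hf he hx) _
      _ = ∑' n : ℕ+, ENNReal.ofReal (|V n| ^ (p + 1 / 2) * D) := by
          rw [lintegral_tsum]
          · exact tsum_congr fun n => lintegral_rpow_mul_sub hp (abs_nonneg _)
          · intro n
            fun_prop
  rw [← ENNReal.ofReal_tsum_of_nonneg
      (fun n => mul_nonneg (Real.rpow_nonneg (abs_nonneg _) _) hD) (hS.mul_right D),
    ← ENNReal.ofReal_sum_of_nonneg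
      (fun i _ => mul_nonneg (Real.rpow_nonneg (abs_nonneg _) _) hB.le),
    tsum_mul_right, ← Finset.sum_mul,
    ENNReal.ofReal_le_ofReal_iff (mul_nonneg hS0 hD)] at h1
  have h2 : ∑ i, |e i| ^ p ≤ D / B * ∑' n : ℕ+, |V n| ^ (p + 1 / 2) := by
    rw [div_mul_eq_mul_div, le_div_iff₀ hB, mul_comm D]
    exact h1
  -- The argument yields the quotient of the two integrals; the factor `√2 ≥ 1` only weakens it.
  refine h2.trans (mul_le_mul_of_nonneg_right ?_ hS0)
  rw [mul_div_assoc]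
  exact le_mul_of_one_le_left (div_nonneg hD hB.le) (Real.one_le_sqrt.2 one_le_two)

theorem exists_orthonormal_of_le_multiplicity {T : L2 →ₗ.[ℂ] L2} {E : ℝ} {m : ℕ}
    (hm : (m : ℕ∞) ≤ multiplicity T E) :
    ∃ g : Fin m → L2, Orthonormal ℂ g ∧ ∀ j, g j ∈ eigenspace T E := by
  obtain ⟨v, hv⟩ := exists_linearIndependent_of_le_rank (Cardinal.natCast_le_toENat.1 hm)
  have h := InnerProductSpace.gramSchmidtNormed_orthonormal hv
  exact ⟨_, h.comp_linearIsometry (eigenspace T E).subtypeₗᵢ, fun j => Subtype.coe_prop _⟩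

theorem sum_natCast_mul_le {p : ℝ} (hp : 1 / 2 < p) {V : lp (fun _ : ℕ+ => ℝ) ∞}
    (hV : Memℓp (fun n : ℕ+ => V n) (ENNReal.ofReal (p + 1 / 2))) (hV2 : ‖V‖ < 2)
    (s : Finset (Iio (0 : ℝ))) {m : Iio (0 : ℝ) → ℕ}
    (hm : ∀ E, (m E : ℕ∞) ≤ multiplicity (hamiltonian V) E) :
    ∑ E ∈ s, (m E : ℝ≥0∞) * ENNReal.ofReal (|(E : ℝ)| ^ p) ≤
      ENNReal.ofReal (ltConst p * ∑' n : ℕ+, |V n| ^ (p + 1 / 2)) := by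
  classical
  choose g hg hgE using fun E => exists_orthonormal_of_le_multiplicity (hm E)
  -- One orthonormal family over all pairs (eigenvalue, index): Gram–Schmidt within each eigenspace,
  -- symmetry of the form between different ones.
  let f : (Σ E : s, Fin (m E)) → L2 := fun i => g i.1 i.2
  have hf : Orthonormal ℂ f := by
    rw [orthonormal_iff_ite]
    rintro ⟨E, j⟩ ⟨F, k⟩
    by_cases hEF : E = F
    · subst hEF
      simpa [f] using orthonormal_iff_ite.1 (hg E) j k
    · rw [if_neg fun h => hEF (congrArg Sigma.fst h)]
      exact inner_eq_zero_of_mem_eigenspace (hgE E j) (hgE F k)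
        fun h => hEF (Subtype.ext (Subtype.ext h))
  have h1 := sum_rpow_le hp hV hV2 hf (e := fun i => ((i.1 : Iio (0 : ℝ)) : ℝ))
    (fun i => hgE i.1 i.2) (fun i => i.1.1.2)
  refine le_trans (le_of_eq ?_) (ENNReal.ofReal_le_ofReal h1)
  rw [ENNReal.ofReal_sum_of_nonneg fun i _ => Real.rpow_nonneg (abs_nonneg _) _,
    Fintype.sum_sigma, ← Finset.sum_coe_sort s]
  refine Finset.sum_congr rfl fun E _ => ?_
  simp

/-- Truncating at `k` replaces a possibly infinite multiplicity by finite ones. The truncations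
increase with `k`, so their supremum can later be exchanged with a finite sum. -/
theorem coe_mul_le_iSup (a : ℕ∞) (x : ℝ≥0∞) :
    (a : ℝ≥0∞) * x ≤ ⨆ k : ℕ, ((min (k : ℕ∞) a).toNat : ℝ≥0∞) * x := by
  rw [← ENNReal.iSup_mul]
  refine mul_le_mul_left ?_ _
  induction a using ENat.recTopCoe with
  | top => simp [ENNReal.iSup_natCast]
  | coe n => exact le_iSup_of_le n (by simp)

end DeltaSchrodinger

open DeltaSchrodinger in
theorem theorem3 (p : ℝ) (hp : 1 / 2 < p) (V : lp (fun _ : ℕ+ => ℝ) ∞)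
    (hV : Memℓp (fun n : ℕ+ => V n) (ENNReal.ofReal (p + 1 / 2))) (hV2 : ‖V‖ < 2) :
    DeltaSchrodinger.negEigenvalueMoment (DeltaSchrodinger.hamiltonian V) p ≤
      ENNReal.ofReal
        (DeltaSchrodinger.ltConst p * ∑' n : ℕ+, |V n| ^ (p + 1 / 2)) := by
  rw [negEigenvalueMoment, ENNReal.tsum_eq_iSup_sum]
  refine iSup_le fun s => ?_
  refine (Finset.sum_le_sum fun E _ => coe_mul_le_iSup _ _).trans ?_
  rw [ENNReal.finsetSum_iSup_of_monotone]
  · refine iSup_le fun k => sum_natCast_mul_le hp hV hV2 s fun E => ?_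
    rw [ENat.natCast_toNat (ne_top_of_le_ne_top (ENat.natCast_ne_top k) (min_le_left _ _))]
    exact min_le_right _ _
  · intro E k l hkl
    refine mul_le_mul_left (Nat.cast_le.2 (ENat.toNat_le_toNat ?_ ?_)) _
    · exact min_le_min_right _ (Nat.cast_le.2 hkl)
    · exact ne_top_of_le_ne_top (ENat.natCast_ne_top l) (min_le_left _ _)
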